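/- Let $\mathcal{A}$ be a finite set of actions with a complementation $\bar{\cdot}:\mathcal{A}\to\mathcal{A}$ satisfying $\bar{\bar a}=a$ and $\bar a\neq a$ for all $a$, let $\tau\notin\mathcal{A}$, and let $\mathcal{A}_\tau=\mathcal{A}\cup\{\tau\}$. Assume $|\mathcal{A}_\tau|\ge 2$. The terms of $\mathrm{BCCSP}_{\|}$ are $t::=\mathbf{0}\mid x\mid \alpha.t\mid t+t\mid t\,\|\,t$, with $\alpha\in\mathcal{A}_\tau$ and $x$ from a countably infinite set of variables; processes are the closed terms. The transition relation on processes is the least one such that $\alpha.p\xrightarrow{\alpha}p$; if $p\xrightarrow{\alpha}p'$ then $p+q\xrightarrow{\alpha}p'$, $q+p\xrightarrow{\alpha}p'$, $p\|q\xrightarrow{\alpha}p'\|q$ and $q\|p\xrightarrow{\alpha}q\|p'$; and if $p\xrightarrow{a}p'$ and $q\xrightarrow{\bar a}q'$ with $a\in\mathcal{A}$, then $p\|q\xrightarrow{\tau}p'\|q'$ and $q\|p\xrightarrow{\tau}q'\|p'$. A possible future of $p$ is a pair $(w,X)$ with $w\in\mathcal{A}_\tau^*$ such that $p\xrightarrow{w}p'$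 for some $p'$ whose set of traces is $X$; $p\sim_{\mathtt{PF}}q$ means that $p$ and $q$ have the same possible futures ($\tau$ is treated like any other action). Let $\sim_{\mathtt{B}}$ be (strong) bisimilarity. A set $\mathcal{E}$ of equations between terms is sound modulo a relation $\mathcal{R}$ on processes if $\sigma(t)\,\mathcal{R}\,\sigma(u)$ for all $(t\approx u)\in\mathcal{E}$ and all closed substitutions $\sigma$; it is ground-complete modulo $\mathcal{R}$ if $p\,\mathcal{R}\,q$ implies $\mathcal{E}\vdash p\approx q$ in equational logic for all processes $p,q$. A finite, ground-complete axiomatisation of $\mathcal{R}$ is a finite set of equations that is sound and ground-complete modulo $\mathcal{R}$. **Theorem.** 1. $\sim_{\mathtt{PF}}$ has no finite, ground-complete axiomatisation over $\mathrm{BCCSP}_{\|}$ with CCS synchronisation. 2. More generally, no congruence $\mathcal{R}$ on processes with ${\sim_{\mathtt{B}}}\subseteq\mathcal{R}\subseteq{\sim_{\mathtt{PF}}}$ has a finite, ground-complete axiomatisation over this language. 3. For $a\in\mathcal{A}$ and $N\ge 1$ put $q_N=\sum_{i=1}^N\tau^i a$ and let $e^c_N$ be the equation $$a\,\|\,q_N\;\approx\;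 a.q_N+\sum_{i=1}^N\tau.(a\,\|\,\tau^{i-1}a).$$ Each $e^c_N$ is sound modulo $\sim_{\mathtt{B}}$ and modulo $\sim_{\mathtt{PF}}$, and for every $a\in\mathcal{A}$ and every finite set $\mathcal{E}$ of equations that is sound modulo $\sim_{\mathtt{PF}}$ there is $N_0$ such that $\mathcal{E}\not\vdash e^c_N$ for all $N\ge N_0$. -/

import Mathlib

namespace BCCSPpar

/-- The action set `A` extended with the silent action `τ`, which is `none`. -/
abbrev ActTau (A : Type*) := Option A

/-- Terms of BCCSP with parallel composition: `0`, variables from `V`, prefixing by an action of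
`A ∪ {τ}`, choice, and parallel composition. -/
inductive Term (A : Type*) (V : Type*) where
  | nil : Term A V
  | var (x : V) : Term A V
  | pre (α : ActTau A) (t : Term A V) : Term A V
  | add (t u : Term A V) : Term A V
  | par (t u : Term A V) : Term A V

/-- Open terms, over the countably infinite set `ℕ` of variables. -/
abbrev OpenTerm (A : Type*) := Term A ℕ

/-- Processes, that is, closed terms: terms over the empty set of variables. -/
abbrev Proc (A : Type*) := Term A Empty

variable {A V W : Type*}

/-- Substitution of terms for variables. -/
def Term.subst (σ : V → Term A W) : Term A V → Term A W
  | .nil => .nil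
  | .var x => σ x
  | .pre α t => .pre α (t.subst σ)
  | .add t u => .add (t.subst σ) (u.subst σ)
  | .par t u => .par (t.subst σ) (u.subst σ)

/-- A closed term regarded as a term of the full language (which happens to have no variables). -/
def Proc.toOpen (p : Proc A) : OpenTerm A := Term.subst (fun x => x.elim) p

/-! ### Operational semantics with CCS synchronisation -/

/-- The transition relation; `bar` is the complementation function on `A`. -/
inductive Step (bar : A → A) : Proc A → ActTau A → Proc A → Prop
  | pre (α : ActTau A) (p : Proc A) : Step bar (.pre α p) α p
  | addLeft {α : ActTau A} {p p' : Proc A} (q : Proc A) :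
      Step bar p α p' → Step bar (.add p q) α p'
  | addRight {α : ActTau A} (p : Proc A) {q q' : Proc A} :
      Step bar q α q' → Step bar (.add p q) α q'
  | parLeft {α : ActTau A} {p p' : Proc A} (q : Proc A) :
      Step bar p α p' → Step bar (.par p q) α (.par p' q)
  | parRight {α : ActTau A} (p : Proc A) {q q' : Proc A} :
      Step bar q α q' → Step bar (.par p q) α (.par p q')
  | syncLeft {a : A} {p p' q q' : Proc A} :
      Step bar p (some a) p' → Step bar q (some (bar a)) q' →
        Step bar (.par p q) none (.par p' q')
  | syncRight {a : A} {p p' q q' : Proc A} :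
      Step bar p (some (bar a)) p' → Step bar q (some a) q' →
        Step bar (.par p q) none (.par p' q')

/-- `Steps bar p w p'`: the process `p` can perform the sequence of actions `w` and become `p'`. -/
def Steps (bar : A → A) : Proc A → List (ActTau A) → Proc A → Prop
  | p, [], p' => p = p'
  | p, α :: w, p' => ∃ q, Step bar p α q ∧ Steps bar q w p'

/-- The set of traces of a process. -/
def traces (bar : A → A) (p : Proc A) : Set (List (ActTau A)) :=
  {w | ∃ p', Steps bar p w p'}

/-- The set of possible futures of a process. -/
def possibleFutures (bar : A → A) (p : Proc A) :
    Set (List (ActTau A) × Set (List (ActTau A))) :=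
  {f | ∃ p', Steps bar p f.1 p' ∧ f.2 = traces bar p'}

/-- Possible futures equivalence. -/
def PFEquiv (bar : A → A) (p q : Proc A) : Prop :=
  possibleFutures bar p = possibleFutures bar q

/-- Simulations. -/
def IsSimulation (bar : A → A) (S : Proc A → Proc A → Prop) : Prop :=
  ∀ p q, S p q → ∀ α p', Step bar p α p' → ∃ q', Step bar q α q' ∧ S p' q'

/-- Bisimilarity: the largest symmetric simulation. -/
def Bisimilar (bar : A → A) (p q : Proc A) : Prop :=
  ∃ S : Proc A → Proc A → Prop,
    (∀ r s, S r s → S s r) ∧ IsSimulation bar S ∧ S p q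

/-- Congruences on processes: equivalence relations preserved by all operators. -/
structure IsCongruence (R : Proc A → Proc A → Prop) : Prop where
  equivalence : Equivalence R
  pre : ∀ α p q, R p q → R (.pre α p) (.pre α q)
  add : ∀ p q p' q', R p q → R p' q' → R (.add p p') (.add q q')
  par : ∀ p q p' q', R p q → R p' q' → R (.par p p') (.par q q')

/-! ### Equational logic -/

/-- An axiom system is a set of equations, an equation being a pair of terms. -/
abbrev AxiomSystem (A : Type*) := Set (OpenTerm A × OpenTerm A)

/-- Derivability of an equation `t ≈ u` from an axiom system in equational logic. -/
inductive Derivable (E : AxiomSystem A) : OpenTerm A → OpenTerm A → Prop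
  | ax {t u : OpenTerm A} : (t, u) ∈ E → Derivable E t u
  | refl (t : OpenTerm A) : Derivable E t t
  | symm {t u : OpenTerm A} : Derivable E t u → Derivable E u t
  | trans {t u v : OpenTerm A} : Derivable E t u → Derivable E u v → Derivable E t v
  | subst {t u : OpenTerm A} (σ : ℕ → OpenTerm A) :
      Derivable E t u → Derivable E (t.subst σ) (u.subst σ)
  | pre {t u : OpenTerm A} (α : ActTau A) :
      Derivable E t u → Derivable E (.pre α t) (.pre α u)
  | add {t u t' u' : OpenTerm A} :
      Derivable E t u → Derivable E t' u' → Derivable E (.add t t') (.add u u')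
  | par {t u t' u' : OpenTerm A} :
      Derivable E t u → Derivable E t' u' → Derivable E (.par t t') (.par u u')

/-- All equations of `E` hold modulo `R` under every closed substitution. -/
def Sound (R : Proc A → Proc A → Prop) (E : AxiomSystem A) : Prop :=
  ∀ t u : OpenTerm A, (t, u) ∈ E → ∀ σ : ℕ → Proc A, R (t.subst σ) (u.subst σ)

/-- Every equation between closed terms that holds modulo `R` is derivable from `E`. -/
def GroundComplete (R : Proc A → Proc A → Prop) (E : AxiomSystem A) : Prop :=
  ∀ p q : Proc A, R p q → Derivable E p.toOpen q.toOpen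

/-- `R` has a finite, ground-complete, equational axiomatisation. -/
def HasFiniteGroundCompleteAxiomatisation (R : Proc A → Proc A → Prop) : Prop :=
  ∃ E : AxiomSystem A, E.Finite ∧ Sound R E ∧ GroundComplete R E

/-! ### The witness family -/

/-- The sum `t₁ + ⋯ + tₖ`, which is `0` if `k = 0` (brackets to the right). -/
def sum : List (Proc A) → Proc A
  | [] => .nil
  | [t] => t
  | t :: u :: ts => .add t (sum (u :: ts))

/-- The process `a.0`. -/
def act (a : A) : Proc A := .pre (some a) .nil

/-- The process `τ^i a`. -/
def tauPow (a : A) : ℕ → Proc A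
  | 0 => act a
  | i + 1 => .pre none (tauPow a i)

/-- The process `q_N = ∑_{i=1}^N τ^i a`. -/
def qProc (a : A) (N : ℕ) : Proc A :=
  sum ((List.range N).map fun j => tauPow a (j + 1))

/-- The left-hand side `a ∥ q_N` of the `N`-th equation of the family. -/
def witnessLeft (a : A) (N : ℕ) : Proc A := .par (act a) (qProc a N)

/-- The right-hand side `a.q_N + ∑_{i=1}^N τ.(a ∥ τ^{i-1} a)`; here `j = i - 1`. -/
def witnessRight (a : A) (N : ℕ) : Proc A :=
  .add (.pre (some a) (qProc a N))
    (sum ((List.range N).map fun j => .pre none (.par (act a) (tauPow a j))))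

end BCCSPpar

/-! Call a process below `a ∥ q_N` if its possible futures for nonempty words are among those of `a
∥ q_N` (`FuturesIncl`). The proof separates the two sides of the witness equation by an invariant on
such processes: up to inert components, having a summand that is a parallel composition of two
active processes and can perform `a` (`HasParSummand`). The left side has one; on the right every
parallel composition is guarded by a prefix.

Processes below `a ∥ q_N` are rigid. Nonempty completed traces end in `a` and contain exactly two
visible actions; after a first `τ` all completed traces have one length; after a first visible
action, which must be `a`, the words `τ^j a` with `1 ≤ j ≤ N` are all completed traces; and
`τ^(N+1)` is not a trace. Since `bar a ≠ a`, no synchronisation interferes.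

The crux is one instance of an axiom `t ≈ u` whose sides have width less than `N`
(`HasParSummand.of_sound`). If the instance of `t` has the property, then after an `a`-step of one
component the other must supply `N` different lengths of completed traces. Prefixes, and variables
whose values have only one length, supply at most one length each, so some exposed variable `x` has
a value with several lengths (`HasParSummand.exists_exposed`). Replacing that value by `τ^(N+1)`
shows that soundness forces `x` to be exposed in `u`, or in a term reached from `u` by `τ`-steps;
the latter contradicts uniform length after `τ`. Conversely, such an exposed variable forces the
property for the instance of `u` (`Distinguishing.hasParSummand`). Closure under the rules of
equational logic is `Derivable.invariant`; a finite axiom system has bounded width, so all large `N`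
are covered. -/

namespace BCCSPpar

variable {A V : Type*} {bar : A → A}

/-! ### Runs, traces and completed traces -/

/-- A process without transitions. -/
def IsNil (bar : A → A) (p : Proc A) : Prop := ∀ α p', ¬ Step bar p α p'

/-- `w` is a completed trace of `p`. -/
def Completed (bar : A → A) (p : Proc A) (w : List (ActTau A)) : Prop :=
  ∃ p', Steps bar p w p' ∧ IsNil bar p'

theorem steps_append {p r : Proc A} {v w : List (ActTau A)} :
    Steps bar p (v ++ w) r ↔ ∃ q, Steps bar p v q ∧ Steps bar q w r := by
  induction v generalizing p with
  | nil => simp [Steps]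
  | cons α v ih =>
    simp only [List.cons_append, Steps, ih]
    constructor
    · rintro ⟨q, h, s, h1, h2⟩; exact ⟨s, ⟨q, h, h1⟩, h2⟩
    · rintro ⟨s, ⟨q, h, h1⟩, h2⟩; exact ⟨q, h, s, h1, h2⟩

theorem nil_isNil : IsNil bar (.nil : Proc A) := by
  intro α p h; cases h

theorem isNil_par {p q : Proc A} : IsNil bar (.par p q) ↔ IsNil bar p ∧ IsNil bar q := by
  constructor
  · exact fun h => ⟨fun α p' hp => h _ _ (.parLeft q hp), fun α q' hq => h _ _ (.parRight p hq)⟩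
  · rintro ⟨hp, hq⟩ α r h
    cases h with
    | parLeft _ h => exact hp _ _ h
    | parRight _ h => exact hq _ _ h
    | syncLeft h _ => exact hp _ _ h
    | syncRight h _ => exact hp _ _ h

theorem IsNil.eq_nil_of_completed {p : Proc A} (hp : IsNil bar p) {w : List (ActTau A)}
    (h : Completed bar p w) : w = [] := by
  obtain ⟨p', h, -⟩ := h
  cases w with
  | nil => rfl
  | cons α w => obtain ⟨q, hq, -⟩ := h; exact (hp _ _ hq).elim

theorem IsNil.completed {p : Proc A} (hp : IsNil bar p) : Completed bar p [] := ⟨p, rfl, hp⟩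

theorem Completed.cons {p q : Proc A} {α : ActTau A} {w : List (ActTau A)}
    (h : Step bar p α q) (hw : Completed bar q w) : Completed bar p (α :: w) := by
  obtain ⟨r, hr, hn⟩ := hw
  exact ⟨r, ⟨q, h, hr⟩, hn⟩

theorem completed_cons {p : Proc A} {α : ActTau A} {w : List (ActTau A)} :
    Completed bar p (α :: w) ↔ ∃ q, Step bar p α q ∧ Completed bar q w := by
  constructor
  · rintro ⟨r, ⟨q, h, hr⟩, hn⟩; exact ⟨q, h, r, hr, hn⟩
  · rintro ⟨q, h, hw⟩; exact hw.cons h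

theorem Completed.of_steps {p q : Proc A} {v w : List (ActTau A)}
    (h : Steps bar p v q) (hw : Completed bar q w) : Completed bar p (v ++ w) := by
  obtain ⟨r, hr, hn⟩ := hw
  exact ⟨r, steps_append.2 ⟨q, h, hr⟩, hn⟩

theorem steps_parLeft {p p' : Proc A} {w : List (ActTau A)} (q : Proc A)
    (h : Steps bar p w p') : Steps bar (.par p q) w (.par p' q) := by
  induction w generalizing p with
  | nil => cases h; rfl
  | cons α w ih => obtain ⟨r, hr, h⟩ := h; exact ⟨_, .parLeft q hr, ih h⟩

theorem steps_parRight {q q' : Proc A} {w : List (ActTau A)} (p : Proc A)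
    (h : Steps bar q w q') : Steps bar (.par p q) w (.par p q') := by
  induction w generalizing q with
  | nil => cases h; rfl
  | cons α w ih => obtain ⟨r, hr, h⟩ := h; exact ⟨_, .parRight p hr, ih h⟩

theorem Completed.par_left_first {p q : Proc A} {v w : List (ActTau A)}
    (hp : Completed bar p v) (hq : Completed bar q w) : Completed bar (.par p q) (v ++ w) := by
  obtain ⟨p', hp, hp'⟩ := hp
  obtain ⟨q', hq, hq'⟩ := hq
  exact ⟨.par p' q', steps_append.2 ⟨_, steps_parLeft q hp, steps_parRight p' hq⟩,
    isNil_par.2 ⟨hp', hq'⟩⟩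

theorem Completed.par_right_first {p q : Proc A} {v w : List (ActTau A)}
    (hp : Completed bar p v) (hq : Completed bar q w) : Completed bar (.par p q) (w ++ v) := by
  obtain ⟨p', hp, hp'⟩ := hp
  obtain ⟨q', hq, hq'⟩ := hq
  exact ⟨.par p' q', steps_append.2 ⟨_, steps_parRight p hq, steps_parLeft q' hp⟩,
    isNil_par.2 ⟨hp', hq'⟩⟩

/-- An upper bound on the length of the runs of a process. -/
def depth : Proc A → ℕ
  | .nil => 0
  | .var x => x.elim
  | .pre _ p => depth p + 1
  | .add p q => depth p + depth q
  | .par p q => depth p + depth q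

theorem Step.depth_lt {p p' : Proc A} {α : ActTau A} (h : Step bar p α p') :
    depth p' < depth p := by
  induction h <;> simp only [depth] <;> omega

theorem exists_completed (p : Proc A) : ∃ w, Completed bar p w := by
  induction h : depth p using Nat.strong_induction_on generalizing p with
  | _ n ih =>
    by_cases hp : IsNil bar p
    · exact ⟨[], hp.completed⟩
    · simp only [IsNil, not_forall, not_not] at hp
      obtain ⟨α, p', hs⟩ := hp
      obtain ⟨w, hw⟩ := ih _ (h ▸ hs.depth_lt) p' rfl
      exact ⟨α :: w, hw.cons hs⟩

theorem Completed.ne_nil {p : Proc A} (hp : ¬ IsNil bar p) {w : List (ActTau A)}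
    (h : Completed bar p w) : w ≠ [] := by
  rintro rfl
  obtain ⟨p', h, hn⟩ := h
  cases h
  exact hp hn

/-- Being inert is visible in the trace set, so a possible future with trivial second component
records a completed trace. -/
theorem isNil_iff_traces {p : Proc A} : IsNil bar p ↔ ∀ w ∈ traces bar p, w = [] := by
  constructor
  · rintro hp w ⟨p', h⟩
    cases w with
    | nil => rfl
    | cons α w => obtain ⟨q, hq, -⟩ := h; exact (hp _ _ hq).elim
  · intro h α p' hs
    exact List.cons_ne_nil _ _ (h [α] ⟨p', p', hs, rfl⟩)

theorem IsNil.congr {p q : Proc A} (hp : IsNil bar p) (h : traces bar p = traces bar q) :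
    IsNil bar q := isNil_iff_traces.2 (h ▸ isNil_iff_traces.1 hp)

/-! ### Runs of parallel compositions -/

/-- `w` arises by interleaving and synchronising `u` and `v`. -/
inductive Merge (bar : A → A) :
    List (ActTau A) → List (ActTau A) → List (ActTau A) → Prop
  | nil : Merge bar [] [] []
  | left (α : ActTau A) {u v w : List (ActTau A)} : Merge bar u v w → Merge bar (α :: u) v (α :: w)
  | right (α : ActTau A) {u v w : List (ActTau A)} : Merge bar u v w → Merge bar u (α :: v) (α :: w)
  | syncLeft (c : A) {u v w : List (ActTau A)} :
      Merge bar u v w → Merge bar (some c :: u) (some (bar c) :: v) (none :: w)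
  | syncRight (c : A) {u v w : List (ActTau A)} :
      Merge bar u v w → Merge bar (some (bar c) :: u) (some c :: v) (none :: w)

theorem Merge.steps {u v w : List (ActTau A)} (h : Merge bar u v w) {p p' q q' : Proc A}
    (hp : Steps bar p u p') (hq : Steps bar q v q') : Steps bar (.par p q) w (.par p' q') := by
  induction h generalizing p q with
  | nil => cases hp; cases hq; rfl
  | left α _ ih => obtain ⟨r, hr, hp⟩ := hp; exact ⟨_, .parLeft _ hr, ih hp hq⟩
  | right α _ ih => obtain ⟨r, hr, hq⟩ := hq; exact ⟨_, .parRight _ hr, ih hp hq⟩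
  | syncLeft c _ ih =>
    obtain ⟨r, hr, hp⟩ := hp
    obtain ⟨s, hs, hq⟩ := hq
    exact ⟨_, .syncLeft hr hs, ih hp hq⟩
  | syncRight c _ ih =>
    obtain ⟨r, hr, hp⟩ := hp
    obtain ⟨s, hs, hq⟩ := hq
    exact ⟨_, .syncRight hr hs, ih hp hq⟩

theorem exists_merge_of_steps_par {p q r : Proc A} {w : List (ActTau A)}
    (h : Steps bar (.par p q) w r) :
    ∃ u v p' q', r = .par p' q' ∧ Merge bar u v w ∧ Steps bar p u p' ∧ Steps bar q v q' := by
  induction w generalizing p q with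
  | nil => cases h; exact ⟨[], [], p, q, rfl, .nil, rfl, rfl⟩
  | cons α w ih =>
    obtain ⟨s, hs, h⟩ := h
    cases hs with
    | parLeft _ hs =>
      obtain ⟨u, v, p', q', rfl, hm, hp, hq⟩ := ih h
      exact ⟨_, _, p', q', rfl, hm.left _, ⟨_, hs, hp⟩, hq⟩
    | parRight _ hs =>
      obtain ⟨u, v, p', q', rfl, hm, hp, hq⟩ := ih h
      exact ⟨_, _, p', q', rfl, hm.right _, hp, ⟨_, hs, hq⟩⟩
    | syncLeft hs ht =>
      obtain ⟨u, v, p', q', rfl, hm, hp, hq⟩ := ih h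
      exact ⟨_, _, p', q', rfl, hm.syncLeft _, ⟨_, hs, hp⟩, ⟨_, ht, hq⟩⟩
    | syncRight hs ht =>
      obtain ⟨u, v, p', q', rfl, hm, hp, hq⟩ := ih h
      exact ⟨_, _, p', q', rfl, hm.syncRight _, ⟨_, hs, hp⟩, ⟨_, ht, hq⟩⟩

theorem traces_par_mono {p q p' q' : Proc A} (h : traces bar p ⊆ traces bar q)
    (h' : traces bar p' ⊆ traces bar q') :
    traces bar (.par p p') ⊆ traces bar (.par q q') := by
  rintro w ⟨r, hr⟩
  obtain ⟨u, v, r1, r2, -, hm, h1, h2⟩ := exists_merge_of_steps_par hr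
  obtain ⟨s1, h1⟩ := h ⟨r1, h1⟩
  obtain ⟨s2, h2⟩ := h' ⟨r2, h2⟩
  exact ⟨_, hm.steps h1 h2⟩

theorem steps_par_isNil_right {p q r : Proc A} (hq : IsNil bar q) {w : List (ActTau A)} :
    Steps bar (.par p q) w r ↔ ∃ p', r = .par p' q ∧ Steps bar p w p' := by
  constructor
  · induction w generalizing p with
    | nil => rintro ⟨⟩; exact ⟨p, rfl, rfl⟩
    | cons α w ih =>
      rintro ⟨s, hs, h⟩
      cases hs with
      | parLeft _ hs => obtain ⟨p', rfl, hp⟩ := ih h; exact ⟨p', rfl, _, hs, hp⟩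
      | parRight _ hs => exact (hq _ _ hs).elim
      | syncLeft _ hs => exact (hq _ _ hs).elim
      | syncRight _ hs => exact (hq _ _ hs).elim
  · rintro ⟨p', rfl, h⟩; exact steps_parLeft q h

theorem steps_par_isNil_left {p q r : Proc A} (hp : IsNil bar p) {w : List (ActTau A)} :
    Steps bar (.par p q) w r ↔ ∃ q', r = .par p q' ∧ Steps bar q w q' := by
  constructor
  · induction w generalizing q with
    | nil => rintro ⟨⟩; exact ⟨q, rfl, rfl⟩
    | cons α w ih =>
      rintro ⟨s, hs, h⟩
      cases hs with
      | parLeft _ hs => exact (hp _ _ hs).elim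
      | parRight _ hs => obtain ⟨p', rfl, hp⟩ := ih h; exact ⟨p', rfl, _, hs, hp⟩
      | syncLeft hs _ => exact (hp _ _ hs).elim
      | syncRight hs _ => exact (hp _ _ hs).elim
  · rintro ⟨q', rfl, h⟩; exact steps_parRight p h

theorem traces_par_isNil_right {p q : Proc A} (hq : IsNil bar q) :
    traces bar (.par p q) = traces bar p := by
  ext w
  simp only [traces, Set.mem_ofPred_eq, steps_par_isNil_right hq]
  exact ⟨fun ⟨_, p', _, h⟩ => ⟨p', h⟩, fun ⟨p', h⟩ => ⟨_, p', rfl, h⟩⟩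

theorem traces_par_isNil_left {p q : Proc A} (hp : IsNil bar p) :
    traces bar (.par p q) = traces bar q := by
  ext w
  simp only [traces, Set.mem_ofPred_eq, steps_par_isNil_left hp]
  exact ⟨fun ⟨_, p', _, h⟩ => ⟨p', h⟩, fun ⟨p', h⟩ => ⟨_, p', rfl, h⟩⟩

theorem Completed.of_par_isNil_right {p q : Proc A} (hq : IsNil bar q) {w : List (ActTau A)}
    (h : Completed bar (.par p q) w) : Completed bar p w := by
  obtain ⟨r, h, hr⟩ := h
  obtain ⟨p', rfl, hp⟩ := (steps_par_isNil_right hq).1 h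
  exact ⟨p', hp, (isNil_par.1 hr).1⟩

theorem Completed.of_par_isNil_left {p q : Proc A} (hp : IsNil bar p) {w : List (ActTau A)}
    (h : Completed bar (.par p q) w) : Completed bar q w := by
  obtain ⟨r, h, hr⟩ := h
  obtain ⟨q', rfl, hq⟩ := (steps_par_isNil_left hp).1 h
  exact ⟨q', hq, (isNil_par.1 hr).2⟩

/-! ### Possible futures equivalence is a congruence -/

/-- The inclusion of possible futures, for nonempty words. -/
def FuturesIncl (bar : A → A) (p q : Proc A) : Prop :=
  ∀ w p', w ≠ [] → Steps bar p w p' → ∃ q', Steps bar q w q' ∧ traces bar p' = traces bar q'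

/-- The empty word is split off because its future is the trace set of the whole process, which a
summand need not share. Without it, every summand lies below the sum. -/
theorem pfEquiv_iff {p q : Proc A} :
    PFEquiv bar p q ↔ traces bar p = traces bar q ∧ FuturesIncl bar p q ∧ FuturesIncl bar q p := by
  constructor
  · intro h
    have key : ∀ {p q : Proc A}, PFEquiv bar p q → ∀ w p', Steps bar p w p' →
        ∃ q', Steps bar q w q' ∧ traces bar p' = traces bar q' := by
      intro p q h w p' hp
      have : (w, traces bar p') ∈ possibleFutures bar q := h ▸ ⟨p', hp, rfl⟩
      exact this
    refine ⟨?_, fun w p' _ => key h w p', fun w p' _ => key h.symm w p'⟩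
    obtain ⟨_, rfl, h⟩ := key h [] p rfl
    exact h
  · rintro ⟨ht, h1, h2⟩
    have key : ∀ {p q : Proc A}, traces bar p = traces bar q → FuturesIncl bar p q →
        possibleFutures bar p ⊆ possibleFutures bar q := by
      rintro p q ht h ⟨w, X⟩ ⟨p', hp, hX⟩
      by_cases hw : w = []
      · subst hw; cases hp; exact ⟨q, rfl, hX.trans ht⟩
      · obtain ⟨q', hq, h⟩ := h w p' hw hp
        exact ⟨q', hq, hX.trans h⟩
    exact (key ht h1).antisymm (key ht.symm h2)

theorem PFEquiv.traces_eq {p q : Proc A} (h : PFEquiv bar p q) : traces bar p = traces bar q :=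
  (pfEquiv_iff.1 h).1

theorem FuturesIncl.trans {p q r : Proc A} (h : FuturesIncl bar p q) (h' : FuturesIncl bar q r) :
    FuturesIncl bar p r := by
  intro w p' hw hp
  obtain ⟨q', hq, e⟩ := h w p' hw hp
  obtain ⟨r', hr, e'⟩ := h' w q' hw hq
  exact ⟨r', hr, e.trans e'⟩

theorem futuresIncl_add_left (p q : Proc A) : FuturesIncl bar p (.add p q) := by
  intro w p' hw hp
  cases w with
  | nil => exact (hw rfl).elim
  | cons α w => obtain ⟨r, hr, h⟩ := hp; exact ⟨p', ⟨r, .addLeft q hr, h⟩, rfl⟩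

theorem futuresIncl_add_right (p q : Proc A) : FuturesIncl bar q (.add p q) := by
  intro w p' hw hp
  cases w with
  | nil => exact (hw rfl).elim
  | cons α w => obtain ⟨r, hr, h⟩ := hp; exact ⟨p', ⟨r, .addRight p hr, h⟩, rfl⟩

theorem futuresIncl_par_isNil_right (p : Proc A) {q : Proc A} (hq : IsNil bar q) :
    FuturesIncl bar p (.par p q) :=
  fun _ _ _ hp => ⟨_, steps_parLeft q hp, (traces_par_isNil_right hq).symm⟩

theorem futuresIncl_par_isNil_left {p : Proc A} (q : Proc A) (hp : IsNil bar p) :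
    FuturesIncl bar q (.par p q) :=
  fun _ _ _ hq => ⟨_, steps_parRight p hq, (traces_par_isNil_left hp).symm⟩

theorem traces_pre {α : ActTau A} {p : Proc A} :
    traces bar (.pre α p) = insert [] ((α :: ·) '' traces bar p) := by
  ext w
  cases w with
  | nil => simp only [Set.mem_insert_iff, true_or, iff_true]; exact ⟨_, rfl⟩
  | cons β w =>
    simp only [Set.mem_insert_iff, reduceCtorEq, false_or, Set.mem_image, List.cons.injEq]
    constructor
    · rintro ⟨r, q, ⟨⟩, h⟩; exact ⟨w, ⟨r, h⟩, rfl, rfl⟩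
    · rintro ⟨_, ⟨r, h⟩, rfl, rfl⟩; exact ⟨r, p, .pre _ _, h⟩

theorem traces_add {p q : Proc A} :
    traces bar (.add p q) = traces bar p ∪ traces bar q := by
  ext w
  cases w with
  | nil => exact ⟨fun _ => .inl ⟨p, rfl⟩, fun _ => ⟨_, rfl⟩⟩
  | cons β w =>
    constructor
    · rintro ⟨r, s, hs, h⟩
      cases hs with
      | addLeft _ hs => exact .inl ⟨r, s, hs, h⟩
      | addRight _ hs => exact .inr ⟨r, s, hs, h⟩
    · rintro (⟨r, s, hs, h⟩ | ⟨r, s, hs, h⟩)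
      · exact ⟨r, s, .addLeft _ hs, h⟩
      · exact ⟨r, s, .addRight _ hs, h⟩

theorem PFEquiv.pre {p q : Proc A} (α : ActTau A) (h : PFEquiv bar p q) :
    PFEquiv bar (.pre α p) (.pre α q) := by
  have key : ∀ {p q : Proc A}, traces bar p = traces bar q → FuturesIncl bar p q →
      FuturesIncl bar (.pre α p) (.pre α q) := by
    rintro p q ht h (_ | ⟨β, w⟩) p' hw hp
    · exact (hw rfl).elim
    · obtain ⟨r, ⟨⟩, hp⟩ := hp
      by_cases hw : w = []
      · subst hw; cases hp; exact ⟨q, ⟨q, .pre _ _, rfl⟩, ht⟩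
      · obtain ⟨q', hq, e⟩ := h w p' hw hp
        exact ⟨q', ⟨q, .pre _ _, hq⟩, e⟩
  obtain ⟨ht, h1, h2⟩ := pfEquiv_iff.1 h
  exact pfEquiv_iff.2 ⟨by rw [traces_pre, traces_pre, ht], key ht h1, key ht.symm h2⟩

theorem FuturesIncl.add {p q p' q' : Proc A} (h : FuturesIncl bar p q)
    (h' : FuturesIncl bar p' q') : FuturesIncl bar (.add p p') (.add q q') := by
  rintro (_ | ⟨β, w⟩) r hw hr
  · exact (hw rfl).elim
  · obtain ⟨s, hs, hr⟩ := hr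
    cases hs with
    | addLeft _ hs => exact (h.trans (futuresIncl_add_left _ _)) _ r hw ⟨s, hs, hr⟩
    | addRight _ hs => exact (h'.trans (futuresIncl_add_right _ _)) _ r hw ⟨s, hs, hr⟩

theorem PFEquiv.add {p q p' q' : Proc A} (h : PFEquiv bar p q) (h' : PFEquiv bar p' q') :
    PFEquiv bar (.add p p') (.add q q') := by
  obtain ⟨ht, h1, h2⟩ := pfEquiv_iff.1 h
  obtain ⟨ht', h1', h2'⟩ := pfEquiv_iff.1 h'
  exact pfEquiv_iff.2 ⟨by rw [traces_add, traces_add, ht, ht'], h1.add h1', h2.add h2'⟩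

/-- Runs of a parallel composition are merges of runs of its components, and the merging depends
only on the words; trace sets and futures therefore transfer componentwise. -/
theorem PFEquiv.par {p q p' q' : Proc A} (h : PFEquiv bar p q) (h' : PFEquiv bar p' q') :
    PFEquiv bar (.par p p') (.par q q') := by
  have lift : ∀ {p q : Proc A}, PFEquiv bar p q → ∀ w r, Steps bar p w r →
      ∃ s, Steps bar q w s ∧ traces bar r = traces bar s := by
    intro p q h w r hr
    obtain ⟨ht, hi, -⟩ := pfEquiv_iff.1 h
    by_cases hw : w = []
    · subst hw; cases hr; exact ⟨q, rfl, ht⟩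
    · exact hi w r hw hr
  have tr : ∀ {p q p' q' : Proc A}, traces bar p = traces bar q → traces bar p' = traces bar q' →
      traces bar (.par p p') = traces bar (.par q q') := fun h h' =>
    (traces_par_mono h.subset h'.subset).antisymm (traces_par_mono h.superset h'.superset)
  have key : ∀ {p q p' q' : Proc A}, PFEquiv bar p q → PFEquiv bar p' q' →
      FuturesIncl bar (.par p p') (.par q q') := by
    intro p q p' q' h h' w r _ hr
    obtain ⟨u, v, r1, r2, rfl, hm, h1, h2⟩ := exists_merge_of_steps_par hr
    obtain ⟨s1, h1, e1⟩ := lift h _ _ h1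
    obtain ⟨s2, h2, e2⟩ := lift h' _ _ h2
    exact ⟨_, hm.steps h1 h2, tr e1 e2⟩
  exact pfEquiv_iff.2 ⟨tr h.traces_eq h'.traces_eq, key h h', key h.symm h'.symm⟩

/-! ### Bisimilarity -/

theorem IsSimulation.steps {S : Proc A → Proc A → Prop} (hS : IsSimulation bar S) {p q p' : Proc A}
    (h : S p q) {w : List (ActTau A)} (hp : Steps bar p w p') :
    ∃ q', Steps bar q w q' ∧ S p' q' := by
  induction w generalizing p q with
  | nil => cases hp; exact ⟨q, rfl, h⟩
  | cons α w ih =>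
    obtain ⟨r, hr, hp⟩ := hp
    obtain ⟨s, hs, h⟩ := hS p q h α r hr
    obtain ⟨q', hq, h⟩ := ih h hp
    exact ⟨q', ⟨s, hs, hq⟩, h⟩

theorem Bisimilar.pfEquiv {p q : Proc A} (h : Bisimilar bar p q) : PFEquiv bar p q := by
  obtain ⟨S, symm, hS, h⟩ := h
  have tr : ∀ {p q : Proc A}, S p q → traces bar p ⊆ traces bar q := by
    rintro p q h w ⟨p', hp⟩
    obtain ⟨q', hq, -⟩ := hS.steps h hp
    exact ⟨q', hq⟩
  have tr' : ∀ {p q : Proc A}, S p q → traces bar p = traces bar q :=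
    fun h => (tr h).antisymm (tr (symm _ _ h))
  have key : ∀ {p q : Proc A}, S p q → FuturesIncl bar p q := by
    intro p q h w p' _ hp
    obtain ⟨q', hq, h⟩ := hS.steps h hp
    exact ⟨q', hq, tr' h⟩
  exact pfEquiv_iff.2 ⟨tr' h, key h, key (symm _ _ h)⟩

/-! ### The witness family -/

theorem step_sum {l : List (Proc A)} {α : ActTau A} {r : Proc A} :
    Step bar (sum l) α r ↔ ∃ p ∈ l, Step bar p α r := by
  induction l using sum.induct with
  | case1 => simp only [sum, List.not_mem_nil, false_and, exists_false, iff_false]; rintro ⟨⟩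
  | case2 t => simp [sum]
  | case3 t u ts ih =>
    rw [sum, List.exists_mem_cons_iff, ← ih]
    constructor
    · intro h
      cases h with
      | addLeft _ h => exact .inl h
      | addRight _ h => exact .inr h
    · rintro (h | h)
      · exact .addLeft _ h
      · exact .addRight _ h

theorem step_pre {α β : ActTau A} {p r : Proc A} :
    Step bar (.pre α p) β r ↔ β = α ∧ r = p := by
  constructor
  · rintro ⟨⟩; exact ⟨rfl, rfl⟩
  · rintro ⟨rfl, rfl⟩; exact .pre _ _

theorem step_qProc {a : A} {N : ℕ} {α : ActTau A} {r : Proc A} :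
    Step bar (qProc a N) α r ↔ α = none ∧ ∃ j < N, r = tauPow a j := by
  simp only [qProc, step_sum, List.mem_map, List.mem_range, exists_exists_and_eq_and, tauPow,
    step_pre]
  tauto

theorem step_witnessLeft {a : A} {N : ℕ} {α : ActTau A} {r : Proc A} :
    Step bar (witnessLeft a N) α r ↔ (α = some a ∧ r = .par .nil (qProc a N)) ∨
      (α = none ∧ ∃ j < N, r = .par (act a) (tauPow a j)) := by
  constructor
  · intro h
    cases h with
    | parLeft _ h => obtain ⟨rfl, rfl⟩ := step_pre.1 h; exact .inl ⟨rfl, rfl⟩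
    | parRight _ h => obtain ⟨rfl, j, hj, rfl⟩ := step_qProc.1 h; exact .inr ⟨rfl, j, hj, rfl⟩
    | syncLeft _ h => exact absurd (step_qProc.1 h).1 (by simp)
    | syncRight _ h => exact absurd (step_qProc.1 h).1 (by simp)
  · rintro (⟨rfl, rfl⟩ | ⟨rfl, j, hj, rfl⟩)
    · exact .parLeft _ (.pre _ _)
    · exact .parRight _ (step_qProc.2 ⟨rfl, j, hj, rfl⟩)

theorem step_witnessRight {a : A} {N : ℕ} {α : ActTau A} {r : Proc A} :
    Step bar (witnessRight a N) α r ↔ (α = some a ∧ r = qProc a N) ∨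
      (α = none ∧ ∃ j < N, r = .par (act a) (tauPow a j)) := by
  have hsum : Step bar (sum ((List.range N).map fun j => .pre none (.par (act a) (tauPow a j)))) α r
      ↔ α = none ∧ ∃ j < N, r = .par (act a) (tauPow a j) := by
    simp only [step_sum, List.mem_map, List.mem_range, exists_exists_and_eq_and, step_pre]
    tauto
  rw [← hsum, ← step_pre (bar := bar), witnessRight]
  constructor
  · intro h
    cases h with
    | addLeft _ h => exact .inl h
    | addRight _ h => exact .inr h
  · rintro (h | h)
    · exact .addLeft _ h
    · exact .addRight _ h

theorem bisimilar_witness (a : A) (N : ℕ) :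
    Bisimilar bar (witnessLeft a N) (witnessRight a N) := by
  -- The first moves of the two sides agree except that after `a` one side retains an inert
  -- component, hence the clauses with `.par .nil`.
  let S : Proc A → Proc A → Prop := fun p q => p = q ∨ p = .par .nil q ∨ q = .par .nil p ∨
    (p = witnessLeft a N ∧ q = witnessRight a N) ∨ (q = witnessLeft a N ∧ p = witnessRight a N)
  refine ⟨S, ?_, ?_, .inr (.inr (.inr (.inl ⟨rfl, rfl⟩)))⟩
  · intro r s h
    rcases h with h | h | h | h | h
    · exact .inl h.symm
    · exact .inr (.inr (.inl h))
    · exact .inr (.inl h)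
    · exact .inr (.inr (.inr (.inr h)))
    · exact .inr (.inr (.inr (.inl h)))
  · rintro p q (rfl | rfl | rfl | ⟨rfl, rfl⟩ | ⟨rfl, rfl⟩) α p' h
    · exact ⟨p', h, .inl rfl⟩
    · cases h with
      | parLeft _ h => exact (nil_isNil _ _ h).elim
      | parRight _ h => exact ⟨_, h, .inr (.inl rfl)⟩
      | syncLeft h _ => exact (nil_isNil _ _ h).elim
      | syncRight h _ => exact (nil_isNil _ _ h).elim
    · exact ⟨_, .parRight _ h, .inr (.inr (.inl rfl))⟩
    · rcases step_witnessLeft.1 h with ⟨rfl, rfl⟩ | h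
      · exact ⟨_, step_witnessRight.2 (.inl ⟨rfl, rfl⟩), .inr (.inl rfl)⟩
      · exact ⟨p', step_witnessRight.2 (.inr h), .inl rfl⟩
    · rcases step_witnessRight.1 h with ⟨rfl, rfl⟩ | h
      · exact ⟨_, step_witnessLeft.2 (.inl ⟨rfl, rfl⟩), .inr (.inr (.inl rfl))⟩
      · exact ⟨p', step_witnessLeft.2 (.inr h), .inl rfl⟩

/-! ### Counting the actions left in residuals of `a ∥ τ^j a` -/

/-- `Residual a m n p`: the process `p` is a residual of some `a ∥ τ^j a` with `m` actions `a` and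
`n` actions `τ` left. -/
inductive Residual (a : A) : ℕ → ℕ → Proc A → Prop
  | both (j : ℕ) : Residual a 2 j (.par (act a) (tauPow a j))
  | right (j : ℕ) : Residual a 1 j (.par .nil (tauPow a j))
  | left : Residual a 1 0 (.par (act a) .nil)
  | done : Residual a 0 0 (.par .nil .nil)

theorem step_tauPow {a : A} {j : ℕ} {α : ActTau A} {r : Proc A} (h : Step bar (tauPow a j) α r) :
    (j = 0 ∧ α = some a ∧ r = .nil) ∨ ∃ i, j = i + 1 ∧ α = none ∧ r = tauPow a i := by
  cases j with
  | zero => obtain ⟨rfl, rfl⟩ := step_pre.1 h; exact .inl ⟨rfl, rfl, rfl⟩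
  | succ i => obtain ⟨rfl, rfl⟩ := step_pre.1 h; exact .inr ⟨i, rfl, rfl, rfl⟩

/-- The only visible action around is `a`, and `bar a ≠ a` rules out synchronisation. The condition
`m ≠ 0` on `τ`-moves is what makes the last action of a complete run visible. -/
theorem Residual.step (bar_ne : ∀ a, bar a ≠ a) {a : A} {m n : ℕ} {p p' : Proc A} {α : ActTau A}
    (hp : Residual a m n p) (h : Step bar p α p') :
    (α = some a ∧ ∃ m', m = m' + 1 ∧ Residual a m' n p') ∨
      (α = none ∧ m ≠ 0 ∧ ∃ n', n = n' + 1 ∧ Residual a m n' p') := by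
  cases hp with
  | both =>
    cases h with
    | parLeft _ h => obtain ⟨rfl, rfl⟩ := step_pre.1 h; exact .inl ⟨rfl, 1, rfl, .right _⟩
    | parRight _ h =>
      rcases step_tauPow h with ⟨rfl, rfl, rfl⟩ | ⟨i, rfl, rfl, rfl⟩
      · exact .inl ⟨rfl, 1, rfl, .left⟩
      · exact .inr ⟨rfl, by simp, i, rfl, .both i⟩
    | @syncLeft c _ _ _ _ h h' =>
      have e := (step_pre.1 h).1
      rcases step_tauPow h' with ⟨rfl, e', -⟩ | ⟨i, -, e', -⟩
      · exact (bar_ne c (Option.some.inj (e'.trans e.symm))).elim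
      · cases e'
    | @syncRight c _ _ _ _ h h' =>
      have e := (step_pre.1 h).1
      rcases step_tauPow h' with ⟨rfl, e', -⟩ | ⟨i, -, e', -⟩
      · exact (bar_ne c (Option.some.inj (e.trans e'.symm))).elim
      · cases e'
  | right =>
    cases h with
    | parLeft _ h => cases h
    | parRight _ h =>
      rcases step_tauPow h with ⟨rfl, rfl, rfl⟩ | ⟨i, rfl, rfl, rfl⟩
      · exact .inl ⟨rfl, 0, rfl, .done⟩
      · exact .inr ⟨rfl, by simp, i, rfl, .right i⟩
    | syncLeft h _ => cases h
    | syncRight h _ => cases h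
  | left =>
    cases h with
    | parLeft _ h => obtain ⟨rfl, rfl⟩ := step_pre.1 h; exact .inl ⟨rfl, 0, rfl, .done⟩
    | parRight _ h => cases h
    | syncLeft _ h => cases h
    | syncRight _ h => cases h
  | done => exact (isNil_par.2 ⟨nil_isNil, nil_isNil⟩ _ _ h).elim

theorem not_isNil_tauPow (a : A) (j : ℕ) : ¬ IsNil bar (tauPow a j) := by
  cases j with
  | zero => exact fun h => h _ _ (.pre _ _)
  | succ i => exact fun h => h _ _ (.pre _ _)

theorem Residual.eq_zero_of_isNil {a : A} {m n : ℕ} {p : Proc A} (hp : Residual a m n p)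
    (h : IsNil bar p) : m = 0 := by
  rw [← not_ne_iff]
  intro hm
  cases hp with
  | both => exact not_isNil_tauPow a _ (isNil_par.1 h).2
  | right => exact not_isNil_tauPow a _ (isNil_par.1 h).2
  | left => exact (isNil_par.1 h).1 _ _ (.pre _ _)
  | done => exact hm rfl

theorem Residual.steps (bar_ne : ∀ a, bar a ≠ a) {a : A} {m n : ℕ} {p p' : Proc A}
    {w : List (ActTau A)} (hp : Residual a m n p) (h : Steps bar p w p') :
    ∃ m' n', Residual a m' n' p' ∧ m = m' + w.countP Option.isSome ∧
      w.length + m' + n' = m + n := by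
  induction w generalizing m n p with
  | nil => cases h; exact ⟨m, n, hp, by simp, by simp⟩
  | cons α w ih =>
    obtain ⟨q, hq, h⟩ := h
    rcases hp.step bar_ne hq with ⟨rfl, k, rfl, hk⟩ | ⟨rfl, -, k, rfl, hk⟩
    · obtain ⟨m', n', hr, e, e'⟩ := ih hk h
      exact ⟨m', n', hr, by simp; omega, by simp; omega⟩
    · obtain ⟨m', n', hr, e, e'⟩ := ih hk h
      exact ⟨m', n', hr, by simp; omega, by simp; omega⟩

theorem Residual.completed (bar_ne : ∀ a, bar a ≠ a) {a : A} {m n : ℕ} {p : Proc A}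
    {w : List (ActTau A)} (hp : Residual a m n p) (h : Completed bar p w) :
    (m = 0 ∧ w = []) ∨ ∃ u, w = u ++ [some a] ∧ u.countP Option.isSome + 1 = m := by
  induction w generalizing m n p with
  | nil => obtain ⟨_, rfl, h⟩ := h; exact .inl ⟨hp.eq_zero_of_isNil h, rfl⟩
  | cons α w ih =>
    obtain ⟨q, hq, hw⟩ := completed_cons.1 h
    rcases hp.step bar_ne hq with ⟨rfl, k, rfl, hk⟩ | ⟨rfl, hm, k, rfl, hk⟩
    · rcases ih hk hw with ⟨rfl, rfl⟩ | ⟨u, rfl, rfl⟩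
      · exact .inr ⟨[], rfl, rfl⟩
      · exact .inr ⟨some a :: u, rfl, by simp⟩
    · rcases ih hk hw with ⟨rfl, rfl⟩ | ⟨u, rfl, rfl⟩
      · exact (hm rfl).elim
      · exact .inr ⟨none :: u, rfl, by simp⟩

theorem Residual.isNil_of_zero {a : A} {n : ℕ} {p : Proc A} (hp : Residual a 0 n p) :
    IsNil bar p ∧ n = 0 := by
  cases hp
  exact ⟨isNil_par.2 ⟨nil_isNil, nil_isNil⟩, rfl⟩

theorem steps_tauPow (a : A) (j : ℕ) :
    Steps bar (tauPow a j) (List.replicate j none ++ [some a]) .nil := by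
  induction j with
  | zero => exact ⟨_, .pre _ _, rfl⟩
  | succ j ih => exact ⟨_, .pre _ _, ih⟩

theorem step_par_nil_qProc {a : A} {N : ℕ} {α : ActTau A} {r : Proc A}
    (h : Step bar (.par .nil (qProc a N)) α r) :
    α = none ∧ ∃ j < N, r = .par .nil (tauPow a j) := by
  cases h with
  | parLeft _ h => cases h
  | parRight _ h => obtain ⟨rfl, j, hj, rfl⟩ := step_qProc.1 h; exact ⟨rfl, j, hj, rfl⟩
  | syncLeft h _ => cases h
  | syncRight h _ => cases h

/-- Trace sets do not determine completed traces in general, but a trace with no extension is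
necessarily completed. -/
theorem Completed.of_traces_maximal {p : Proc A} {w : List (ActTau A)} (h : w ∈ traces bar p)
    (h' : ∀ α, w ++ [α] ∉ traces bar p) : Completed bar p w := by
  obtain ⟨p', h⟩ := h
  exact ⟨p', h, fun α q hq => h' α ⟨q, steps_append.2 ⟨p', h, q, hq, rfl⟩⟩⟩

/-! ### Processes whose possible futures are among those of `a ∥ q_N` -/

section

variable {a : A} {N : ℕ} {p p' : Proc A}

theorem completed_of_futuresIncl (bar_ne : ∀ a, bar a ≠ a) (hN : 1 ≤ N)
    (hp : FuturesIncl bar p (witnessLeft a N)) {w : List (ActTau A)} (hw : w ≠ [])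
    (h : Completed bar p w) : ∃ u, w = u ++ [some a] ∧ u.countP Option.isSome = 1 := by
  obtain ⟨p', h, hn⟩ := h
  obtain ⟨q, hq, e⟩ := hp w p' hw h
  replace hq : Completed bar (witnessLeft a N) w := ⟨q, hq, hn.congr e⟩
  cases w with
  | nil => exact (hw rfl).elim
  | cons α w =>
    obtain ⟨r, hr, hq⟩ := completed_cons.1 hq
    rcases step_witnessLeft.1 hr with ⟨rfl, rfl⟩ | ⟨rfl, j, hj, rfl⟩
    · cases w with
      | nil =>
        obtain ⟨_, rfl, hq⟩ := hq
        exact (hq _ _ (.parRight _ (step_qProc.2 ⟨rfl, 0, hN, rfl⟩))).elim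
      | cons β w =>
        obtain ⟨s, hs, hq⟩ := completed_cons.1 hq
        obtain ⟨rfl, j, hj, rfl⟩ := step_par_nil_qProc hs
        rcases (Residual.right j).completed bar_ne hq with ⟨h, -⟩ | ⟨u, rfl, hu⟩
        · cases h
        · exact ⟨some a :: none :: u, rfl, by simp at hu ⊢; exact hu⟩
    · rcases (Residual.both j).completed bar_ne hq with ⟨h, -⟩ | ⟨u, rfl, h⟩
      · cases h
      · exact ⟨none :: u, rfl, by simp; omega⟩

/-- All completed traces of `p` have the same length. -/
def UniformLength (bar : A → A) (p : Proc A) : Prop :=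
  ∃ l, ∀ w, Completed bar p w → w.length = l

/-- The derivative has the traces of some `a ∥ τ^j a`. A completed trace of it carries two visible
actions, hence exhausts the residual, including its `j` silent steps. -/
theorem uniformLength_of_step_tau (bar_ne : ∀ a, bar a ≠ a) (hN : 1 ≤ N)
    (hp : FuturesIncl bar p (witnessLeft a N)) (h : Step bar p none p') :
    UniformLength bar p' := by
  obtain ⟨q, ⟨r, hr, hq⟩, e⟩ := hp [none] p' (by simp) ⟨p', h, rfl⟩
  cases hq
  rcases step_witnessLeft.1 hr with ⟨h, -⟩ | ⟨-, j, hj, rfl⟩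
  · cases h
  refine ⟨2 + j, fun w hw => ?_⟩
  obtain ⟨u, hu, hc⟩ := completed_of_futuresIncl bar_ne hN hp (by simp) (hw.cons h)
  have hc' : w.countP Option.isSome = 2 := by
    have := congrArg (List.countP Option.isSome) hu
    simpa [hc] using this
  obtain ⟨s, hs⟩ : w ∈ traces bar (.par (act a) (tauPow a j)) := by
    obtain ⟨s, hs, -⟩ := hw
    exact e ▸ ⟨s, hs⟩
  obtain ⟨m', n', hr, e1, e2⟩ := (Residual.both j).steps bar_ne hs
  obtain rfl : m' = 0 := by omega
  have := (hr.isNil_of_zero (bar := bar)).2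
  omega

theorem traces_eq_of_step_some (hp : FuturesIncl bar p (witnessLeft a N)) {b : A}
    (h : Step bar p (some b) p') :
    b = a ∧ traces bar p' = traces bar (.par .nil (qProc a N)) := by
  obtain ⟨q, ⟨r, hr, hq⟩, e⟩ := hp [some b] p' (by simp) ⟨p', h, rfl⟩
  cases hq
  rcases step_witnessLeft.1 hr with ⟨h, rfl⟩ | ⟨h, -⟩
  · exact ⟨Option.some.inj h, e⟩
  · cases h

theorem not_step_some_of_step_some (hp : FuturesIncl bar p (witnessLeft a N)) {b c : A}
    {r : Proc A} (h : Step bar p (some b) p') : ¬ Step bar p' (some c) r := by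
  intro hr
  obtain ⟨s, t, ht, -⟩ : [some c] ∈ traces bar (.par .nil (qProc a N)) :=
    (traces_eq_of_step_some hp h).2 ▸ ⟨r, r, hr, rfl⟩
  cases (step_par_nil_qProc ht).1

theorem completed_of_step_some (bar_ne : ∀ a, bar a ≠ a)
    (hp : FuturesIncl bar p (witnessLeft a N)) {b : A} (h : Step bar p (some b) p') {j : ℕ}
    (hj : j < N) : Completed bar p' (List.replicate (j + 1) none ++ [some a]) := by
  have e := (traces_eq_of_step_some hp h).2
  apply Completed.of_traces_maximal
  · rw [e]
    exact ⟨_, steps_parRight _ ⟨_, step_qProc.2 ⟨rfl, j, hj, rfl⟩, steps_tauPow a j⟩⟩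
  · rintro α hα
    -- Peeling off the first `τ` resolves the choice in `q_N`; the single `a` of the remaining
    -- residual is then spent, so nothing can follow.
    rw [e, List.append_assoc, List.replicate_succ, List.cons_append, ← List.append_assoc] at hα
    obtain ⟨r, s, hs, hr⟩ := hα
    obtain ⟨-, i, -, rfl⟩ := step_par_nil_qProc hs
    obtain ⟨t, ht, x, hx, -⟩ := steps_append.1 hr
    obtain ⟨m', n', hres, e1, -⟩ := (Residual.right i).steps bar_ne ht
    rw [List.countP_append, List.countP_singleton, Option.isSome_some, if_pos rfl] at e1
    obtain rfl : m' = 0 := by omega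
    exact hres.isNil_of_zero.1 _ _ hx

/-- The first `τ` leads to a future of `a ∥ τ^j a` with `j < N`, which offers at most `N - 1`
further silent steps. -/
theorem replicate_none_notMem_traces (bar_ne : ∀ a, bar a ≠ a)
    (hp : FuturesIncl bar p (witnessLeft a N)) : List.replicate (N + 1) none ∉ traces bar p := by
  rintro ⟨r, hr⟩
  obtain ⟨q, ⟨s, hs, hq⟩, -⟩ := hp _ r (by simp) hr
  rcases step_witnessLeft.1 hs with ⟨h, -⟩ | ⟨-, j, hj, rfl⟩
  · cases h
  · obtain ⟨m', n', -, e1, e2⟩ := (Residual.both j).steps bar_ne hq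
    simp only [List.countP_replicate, Option.isSome_none, Bool.false_eq_true, if_false,
      List.length_replicate] at e1 e2
    omega

end

theorem Step.par_comm {p q r : Proc A} {α : ActTau A} (h : Step bar (.par p q) α r) :
    ∃ p' q', r = .par p' q' ∧ Step bar (.par q p) α (.par q' p') := by
  cases h with
  | parLeft _ h => exact ⟨_, _, rfl, .parRight _ h⟩
  | parRight _ h => exact ⟨_, _, rfl, .parLeft _ h⟩
  | syncLeft h h' => exact ⟨_, _, rfl, .syncRight h' h⟩
  | syncRight h h' => exact ⟨_, _, rfl, .syncLeft h' h⟩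

theorem Completed.par_comm {p q : Proc A} {w : List (ActTau A)}
    (h : Completed bar (.par p q) w) : Completed bar (.par q p) w := by
  induction w generalizing p q with
  | nil =>
    obtain ⟨_, rfl, h⟩ := h
    exact (isNil_par.2 (isNil_par.1 h).symm).completed
  | cons α w ih =>
    obtain ⟨r, hr, h⟩ := completed_cons.1 h
    obtain ⟨p', q', rfl, hs⟩ := hr.par_comm
    exact (ih h).cons hs

/-! ### Exposed variables -/

/-- The variable `x` occurs in `t` outside the scope of all prefixes. -/
def Term.Exposed (x : V) : Term A V → Prop
  | .nil => False
  | .var y => y = x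
  | .pre _ _ => False
  | .add t u => t.Exposed x ∨ u.Exposed x
  | .par t u => t.Exposed x ∨ u.Exposed x

/-- An upper bound on the number of occurrences of variables and prefixes in `t` that are not in the
scope of a prefix. -/
def Term.width : Term A V → ℕ
  | .nil => 0
  | .var _ => 1
  | .pre _ _ => 1
  | .add t u => t.width + u.width
  | .par t u => t.width + u.width

/-- Run the variable first and then finish its parallel partners. The suffix `v` does not depend on
`w`, so differences in length survive; `w ≠ []` is needed to resolve sums. -/
theorem Term.Exposed.exists_completed_append {x : V} {σ : V → Proc A} {t : Term A V}
    (h : t.Exposed x) : ∃ v, ∀ w, w ≠ [] → Completed bar (σ x) w →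
      Completed bar (t.subst σ) (w ++ v) := by
  induction t with
  | nil => exact h.elim
  | var y => cases h; exact ⟨[], fun w _ hw => by rwa [List.append_nil]⟩
  | pre α t => exact h.elim
  | add t u iht ihu =>
    rcases h with h | h
    · obtain ⟨v, hv⟩ := iht h
      refine ⟨v, fun w hw hc => ?_⟩
      obtain ⟨α, w, rfl⟩ := List.exists_cons_of_ne_nil hw
      obtain ⟨q, hq, hc⟩ := completed_cons.1 (hv _ hw hc)
      exact hc.cons (.addLeft _ hq)
    · obtain ⟨v, hv⟩ := ihu h
      refine ⟨v, fun w hw hc => ?_⟩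
      obtain ⟨α, w, rfl⟩ := List.exists_cons_of_ne_nil hw
      obtain ⟨q, hq, hc⟩ := completed_cons.1 (hv _ hw hc)
      exact hc.cons (.addRight _ hq)
  | par t u iht ihu =>
    rcases h with h | h
    · obtain ⟨v, hv⟩ := iht h
      obtain ⟨v', hv'⟩ := exists_completed (bar := bar) (u.subst σ)
      refine ⟨v ++ v', fun w hw hc => ?_⟩
      rw [← List.append_assoc]
      exact (hv w hw hc).par_left_first hv'
    · obtain ⟨v, hv⟩ := ihu h
      obtain ⟨v', hv'⟩ := exists_completed (bar := bar) (t.subst σ)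
      refine ⟨v ++ v', fun w hw hc => ?_⟩
      rw [← List.append_assoc]
      exact hv'.par_right_first (hv w hw hc)

theorem Term.Exposed.traces_subset {x : V} {σ : V → Proc A} {t : Term A V} (h : t.Exposed x) :
    traces bar (σ x) ⊆ traces bar (t.subst σ) := by
  induction t with
  | nil => exact h.elim
  | var y => cases h; exact subset_rfl
  | pre α t => exact h.elim
  | add t u iht ihu =>
    rw [Term.subst, traces_add]
    rcases h with h | h
    · exact (iht h).trans Set.subset_union_left
    · exact (ihu h).trans Set.subset_union_right
  | par t u iht ihu =>
    rcases h with h | h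
    · exact (iht h).trans fun _ ⟨p, hp⟩ => ⟨_, steps_parLeft _ hp⟩
    · exact (ihu h).trans fun _ ⟨p, hp⟩ => ⟨_, steps_parRight _ hp⟩

/-! ### Changing the value of one variable -/

/-- A process regarded as a term over the variables `V`. -/
def Proc.lift (V : Type*) (p : Proc A) : Term A V := p.subst fun x => x.elim

theorem Proc.subst_lift (σ : V → Proc A) (p : Proc A) : (p.lift V).subst σ = p := by
  induction p with
  | nil => rfl
  | var x => exact x.elim
  | pre α p ih => exact congrArg _ ih
  | add p q ihp ihq => exact congrArg₂ _ ihp ihq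
  | par p q ihp ihq => exact congrArg₂ _ ihp ihq

/-- As long as `x` is guarded, its value cannot influence the next step, so both substitutions share
an open derivative. -/
theorem Step.of_not_exposed {x : V} {σ σ' : V → Proc A} (hσ : ∀ y, y ≠ x → σ' y = σ y)
    {t : Term A V} (ht : ¬ t.Exposed x) {α : ActTau A} {r : Proc A}
    (h : Step bar (t.subst σ') α r) :
    ∃ t' : Term A V, r = t'.subst σ' ∧ Step bar (t.subst σ) α (t'.subst σ) := by
  induction t generalizing α r with
  | nil => cases h
  | var y =>
    refine ⟨r.lift V, (r.subst_lift σ').symm, ?_⟩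
    rw [r.subst_lift σ]
    rw [Term.subst, hσ y ht] at h
    exact h
  | pre β t => obtain ⟨rfl, rfl⟩ := step_pre.1 h; exact ⟨t, rfl, .pre _ _⟩
  | add t u iht ihu =>
    rw [Term.Exposed, not_or] at ht
    cases h with
    | addLeft _ h => obtain ⟨t', rfl, hs⟩ := iht ht.1 h; exact ⟨t', rfl, .addLeft _ hs⟩
    | addRight _ h => obtain ⟨t', rfl, hs⟩ := ihu ht.2 h; exact ⟨t', rfl, .addRight _ hs⟩
  | par t u iht ihu =>
    rw [Term.Exposed, not_or] at ht
    cases h with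
    | parLeft _ h => obtain ⟨t', rfl, hs⟩ := iht ht.1 h; exact ⟨.par t' u, rfl, .parLeft _ hs⟩
    | parRight _ h => obtain ⟨t', rfl, hs⟩ := ihu ht.2 h; exact ⟨.par t t', rfl, .parRight _ hs⟩
    | syncLeft h h' =>
      obtain ⟨t', rfl, hs⟩ := iht ht.1 h
      obtain ⟨u', rfl, hs'⟩ := ihu ht.2 h'
      exact ⟨.par t' u', rfl, .syncLeft hs hs'⟩
    | syncRight h h' =>
      obtain ⟨t', rfl, hs⟩ := iht ht.1 h
      obtain ⟨u', rfl, hs'⟩ := ihu ht.2 h'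
      exact ⟨.par t' u', rfl, .syncRight hs hs'⟩

/-- Follow the trace until `x` first becomes exposed; up to that point the run is available under
`σ` as well. -/
theorem exists_exposed_of_mem_traces {x : V} {σ σ' : V → Proc A} (hσ : ∀ y, y ≠ x → σ' y = σ y)
    {t : Term A V} {w : List (ActTau A)} (h : w ∈ traces bar (t.subst σ')) :
    w ∈ traces bar (t.subst σ) ∨ ∃ (v : List (ActTau A)) (t' : Term A V), v <+: w ∧
      Steps bar (t.subst σ) v (t'.subst σ) ∧ t'.Exposed x := by
  induction w generalizing t with
  | nil => exact .inl ⟨_, rfl⟩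
  | cons α w ih =>
    by_cases ht : t.Exposed x
    · exact .inr ⟨[], t, List.nil_prefix, rfl, ht⟩
    obtain ⟨r, s, hs, hr⟩ := h
    obtain ⟨t', rfl, hs'⟩ := hs.of_not_exposed hσ ht
    rcases ih ⟨r, hr⟩ with ⟨q, hq⟩ | ⟨v, u, hv, hu, hx⟩
    · exact .inl ⟨q, _, hs', hq⟩
    · exact .inr ⟨α :: v, u, List.cons_prefix_cons.2 ⟨rfl, hv⟩, ⟨_, hs', hu⟩, hx⟩

/-! ### Lengths of completed traces -/

/-- Two nonempty completed traces of different lengths. -/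
def TwoLengths (bar : A → A) (p : Proc A) : Prop :=
  ∃ v w, v ≠ [] ∧ w ≠ [] ∧ Completed bar p v ∧ Completed bar p w ∧ v.length ≠ w.length

theorem Term.Exposed.twoLengths {x : V} {σ : V → Proc A} {t : Term A V} (h : t.Exposed x)
    (hx : TwoLengths bar (σ x)) : TwoLengths bar (t.subst σ) := by
  obtain ⟨u, hu⟩ := h.exists_completed_append (bar := bar) (σ := σ)
  obtain ⟨v, w, hv, hw, cv, cw, hne⟩ := hx
  exact ⟨v ++ u, w ++ u, by simp [hv], by simp [hw], hu v hv cv, hu w hw cw, by simpa using hne⟩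

theorem TwoLengths.not_isNil {p : Proc A} (h : TwoLengths bar p) : ¬ IsNil bar p := by
  obtain ⟨v, -, hv, -, cv, -⟩ := h
  exact fun hp => hv (hp.eq_nil_of_completed cv)

theorem UniformLength.not_twoLengths {p : Proc A} (h : UniformLength bar p) :
    ¬ TwoLengths bar p := by
  obtain ⟨l, hl⟩ := h
  rintro ⟨v, w, -, -, cv, cw, hne⟩
  exact hne ((hl v cv).trans (hl w cw).symm)

theorem TwoLengths.par_left {p : Proc A} (h : TwoLengths bar p) (q : Proc A) :
    TwoLengths bar (.par p q) := by
  obtain ⟨v, w, hv, hw, cv, cw, hne⟩ := h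
  obtain ⟨u, hu⟩ := exists_completed (bar := bar) q
  exact ⟨v ++ u, w ++ u, by simp [hv], by simp [hw], cv.par_left_first hu, cw.par_left_first hu,
    by simpa using hne⟩

theorem TwoLengths.par_right {q : Proc A} (h : TwoLengths bar q) (p : Proc A) :
    TwoLengths bar (.par p q) := by
  obtain ⟨v, w, hv, hw, cv, cw, hne⟩ := h
  obtain ⟨u, hu⟩ := exists_completed (bar := bar) p
  exact ⟨v ++ u, w ++ u, by simp [hv], by simp [hw], hu.par_right_first cv, hu.par_right_first cw,
    by simpa using hne⟩

theorem TwoLengths.steps {p q : Proc A} {v : List (ActTau A)} (hs : Steps bar p v q)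
    (h : TwoLengths bar q) : TwoLengths bar p := by
  obtain ⟨x, y, hx, hy, cx, cy, hne⟩ := h
  exact ⟨v ++ x, v ++ y, by simp [hx], by simp [hy], cx.of_steps hs, cy.of_steps hs,
    by simpa using hne⟩

/-- A proper prefix of `τ^k a` is silent. Reading the two concatenations in turn makes both `v` and
`w` silent, leaving no room for the `a`. -/
theorem not_countP_append {a : A} {v w : List (ActTau A)} (hv : v ≠ []) (hw : w ≠ [])
    (h : ∃ u, v ++ w = u ++ [some a] ∧ u.countP Option.isSome = 0)
    (h' : ∃ u, w ++ v = u ++ [some a] ∧ u.countP Option.isSome = 0) : False := by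
  have key : ∀ {v w : List (ActTau A)}, w ≠ [] →
      (∃ u, v ++ w = u ++ [some a] ∧ u.countP Option.isSome = 0) →
      v.countP Option.isSome = 0 := by
    rintro v w hw ⟨u, e, hu⟩
    obtain ⟨w, β, rfl⟩ := List.eq_nil_or_concat'  w |>.resolve_left hw
    rw [← List.append_assoc] at e
    obtain ⟨rfl, -⟩ := List.append_inj' e rfl
    rw [List.countP_append] at hu
    omega
  obtain ⟨u, e, hu⟩ := h
  have := congrArg (List.countP Option.isSome) e
  simp [List.countP_append, key hw ⟨u, e, hu⟩, key hv h', hu] at this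

/-- If no exposed variable of `t` is mapped to a process with completed traces of two lengths, the
number of lengths of completed traces of `t.subst σ` is at most the width of `t`. -/
theorem exists_lengths_card_le_width {a : A} {σ : V → Proc A} {t : Term A V}
    (hx : ∀ x, t.Exposed x → ¬ TwoLengths bar (σ x))
    (hu : ∀ α p, Step bar (t.subst σ) α p → UniformLength bar p)
    (hc : ∀ w, w ≠ [] → Completed bar (t.subst σ) w →
      ∃ u, w = u ++ [some a] ∧ u.countP Option.isSome = 0) :
    ∃ S : Finset ℕ, S.card ≤ t.width ∧
      ∀ w, w ≠ [] → Completed bar (t.subst σ) w → w.length ∈ S := by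
  induction t with
  | nil => exact ⟨∅, by simp, fun w hw h => (hw (nil_isNil.eq_nil_of_completed h)).elim⟩
  | var x =>
    have hx := hx x rfl
    by_cases h : ∃ w, w ≠ [] ∧ Completed bar (σ x) w
    · obtain ⟨w, hw, cw⟩ := h
      refine ⟨{w.length}, by simp [Term.width], fun v hv cv => ?_⟩
      rw [Finset.mem_singleton]
      by_contra hne
      exact hx ⟨v, w, hv, hw, cv, cw, hne⟩
    · exact ⟨∅, by simp, fun w hw cw => (h ⟨w, hw, cw⟩).elim⟩
  | pre α t =>
    obtain ⟨l, hl⟩ := hu α _ (.pre _ _)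
    refine ⟨{l + 1}, by simp [Term.width], fun w hw cw => ?_⟩
    obtain ⟨β, w, rfl⟩ := List.exists_cons_of_ne_nil hw
    obtain ⟨q, hq, cw⟩ := completed_cons.1 cw
    obtain ⟨rfl, rfl⟩ := step_pre.1 hq
    simp [hl w cw]
  | add t u iht ihu =>
    have left : ∀ w, w ≠ [] → Completed bar (t.subst σ) w →
        Completed bar ((t.add u).subst σ) w := by
      intro w hw cw
      obtain ⟨β, w, rfl⟩ := List.exists_cons_of_ne_nil hw
      obtain ⟨q, hq, cw⟩ := completed_cons.1 cw
      exact cw.cons (.addLeft _ hq)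
    have right : ∀ w, w ≠ [] → Completed bar (u.subst σ) w →
        Completed bar ((t.add u).subst σ) w := by
      intro w hw cw
      obtain ⟨β, w, rfl⟩ := List.exists_cons_of_ne_nil hw
      obtain ⟨q, hq, cw⟩ := completed_cons.1 cw
      exact cw.cons (.addRight _ hq)
    obtain ⟨S, hS, hS'⟩ := iht (fun x h => hx x (.inl h)) (fun α p h => hu α p (.addLeft _ h))
      (fun w hw cw => hc w hw (left w hw cw))
    obtain ⟨T, hT, hT'⟩ := ihu (fun x h => hx x (.inr h)) (fun α p h => hu α p (.addRight _ h))
      (fun w hw cw => hc w hw (right w hw cw))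
    refine ⟨S ∪ T, (Finset.card_union_le S T).trans (add_le_add hS hT), fun w hw cw => ?_⟩
    obtain ⟨β, w, rfl⟩ := List.exists_cons_of_ne_nil hw
    obtain ⟨q, hq, cw⟩ := completed_cons.1 cw
    rw [Finset.mem_union]
    cases hq with
    | addLeft _ hq => exact .inl (hS' _ hw (cw.cons hq))
    | addRight _ hq => exact .inr (hT' _ hw (cw.cons hq))
  | par t u iht ihu =>
    by_cases hnu : IsNil bar (u.subst σ)
    · have left : ∀ w, Completed bar (t.subst σ) w → Completed bar ((t.par u).subst σ) w :=
        fun w cw => List.append_nil w ▸ cw.par_left_first hnu.completed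
      obtain ⟨S, hS, hS'⟩ := iht (fun x h => hx x (.inl h))
        (fun α p h => by
          obtain ⟨l, hl⟩ := hu α _ (.parLeft _ h)
          exact ⟨l, fun w cw => hl w (by simpa using cw.par_left_first hnu.completed)⟩)
        (fun w hw cw => hc w hw (left w cw))
      exact ⟨S, hS.trans (Nat.le_add_right _ _),
        fun w hw cw => hS' w hw (cw.of_par_isNil_right hnu)⟩
    by_cases hnt : IsNil bar (t.subst σ)
    · have right : ∀ w, Completed bar (u.subst σ) w → Completed bar ((t.par u).subst σ) w :=
        fun w cw => hnt.completed.par_left_first cw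
      obtain ⟨S, hS, hS'⟩ := ihu (fun x h => hx x (.inr h))
        (fun α p h => by
          obtain ⟨l, hl⟩ := hu α _ (.parRight _ h)
          exact ⟨l, fun w cw => hl w (hnt.completed.par_left_first cw)⟩)
        (fun w hw cw => hc w hw (right w cw))
      exact ⟨S, hS.trans (Nat.le_add_left _ _),
        fun w hw cw => hS' w hw (cw.of_par_isNil_left hnt)⟩
    -- Two active components could be completed in either order, which the shape `τ^k a` forbids. So
    -- parallel composition never multiplies the lengths.
    exfalso
    obtain ⟨v, cv⟩ := exists_completed (bar := bar) (t.subst σ)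
    obtain ⟨w, cw⟩ := exists_completed (bar := bar) (u.subst σ)
    have hv := cv.ne_nil hnt
    have hw := cw.ne_nil hnu
    exact not_countP_append hv hw (hc _ (by simp [hv]) (cv.par_left_first cw))
      (hc _ (by simp [hv]) (cv.par_right_first cw))

/-! ### Parallel summands that can perform `a` -/

/-- Up to parallel components without transitions, the process has a summand that is a parallel
composition of two processes with transitions and can perform `a`. -/
def HasParSummand (bar : A → A) (a : A) : Proc A → Prop
  | .nil => False
  | .var x => x.elim
  | .pre _ _ => False
  | .add p q => HasParSummand bar a p ∨ HasParSummand bar a q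
  | .par p q => (IsNil bar q ∧ HasParSummand bar a p) ∨ (IsNil bar p ∧ HasParSummand bar a q) ∨
      (¬ IsNil bar p ∧ ¬ IsNil bar q ∧ ∃ r, Step bar (.par p q) (some a) r)

theorem HasParSummand.exists_step {a : A} {p : Proc A} (h : HasParSummand bar a p) :
    ∃ r, Step bar p (some a) r := by
  induction p with
  | nil => exact h.elim
  | var x => exact x.elim
  | pre α p => exact h.elim
  | add p q ihp ihq =>
    rcases h with h | h
    · obtain ⟨r, hr⟩ := ihp h; exact ⟨r, .addLeft _ hr⟩
    · obtain ⟨r, hr⟩ := ihq h; exact ⟨r, .addRight _ hr⟩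
  | par p q ihp ihq =>
    rcases h with ⟨-, h⟩ | ⟨-, h⟩ | ⟨-, -, h⟩
    · obtain ⟨r, hr⟩ := ihp h; exact ⟨_, .parLeft _ hr⟩
    · obtain ⟨r, hr⟩ := ihq h; exact ⟨_, .parRight _ hr⟩
    · exact h

theorem twoLengths_of_step_some (bar_ne : ∀ a, bar a ≠ a) {a b : A} {N : ℕ} (hN : 2 ≤ N)
    {p p' : Proc A} (hp : FuturesIncl bar p (witnessLeft a N)) (h : Step bar p (some b) p') :
    TwoLengths bar p :=
  ⟨_, _, List.cons_ne_nil _ _, List.cons_ne_nil _ _,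
    (completed_of_step_some bar_ne hp h (j := 0) (by omega)).cons h,
    (completed_of_step_some bar_ne hp h (j := 1) (by omega)).cons h, by simp⟩

section

variable {a : A} {N : ℕ}

/-- The property of the value of an exposed variable that forces any equivalent term below `a ∥ q_N`
to have a parallel summand that can perform `a`. -/
def Distinguishing (bar : A → A) (a : A) (p : Proc A) : Prop :=
  TwoLengths bar p ∧ (HasParSummand bar a p ∨
    ∃ w, w ≠ [] ∧ Completed bar p w ∧ w.countP Option.isSome ≤ 1)

/-- If `p'` is what a step labelled `b` leaves of the component beside `t.subst σ` in a parallel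
composition below `a ∥ q_N`, then a term `t` of small width has a distinguishing variable. -/
theorem exists_exposed_of_step_some {b : A} {p' : Proc A}
    {t : Term A V} {σ : V → Proc A} (ht : t.width < N) (hn : ¬ IsNil bar (t.subst σ))
    (hl : ∀ w, Completed bar p' w → ∀ v, Completed bar (t.subst σ) v →
      ∃ u, some b :: (w ++ v) = u ++ [some a] ∧ u.countP Option.isSome = 1)
    (hl' : ∀ w, Completed bar p' w → ∀ v, Completed bar (t.subst σ) v →
      ∃ u, some b :: (v ++ w) = u ++ [some a] ∧ u.countP Option.isSome = 1)
    (hu : ∀ α q, Step bar (t.subst σ) α q → UniformLength bar q)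
    (hc : ∀ j < N, Completed bar (.par p' (t.subst σ)) (List.replicate (j + 1) none ++ [some a])) :
    ∃ x, t.Exposed x ∧ Distinguishing bar a (σ x) := by
  have cut : ∀ {l : List (ActTau A)}, l ≠ [] →
      (∃ u, some b :: l = u ++ [some a] ∧ u.countP Option.isSome = 1) →
      ∃ u, l = u ++ [some a] ∧ u.countP Option.isSome = 0 := by
    rintro l hl ⟨u, e, hu⟩
    cases u with
    | nil => simp at e; exact (hl e.2).elim
    | cons β u =>
      obtain ⟨rfl, rfl⟩ := List.cons.inj e
      exact ⟨u, rfl, by simpa using hu⟩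
  -- After `b` only one visible action is left, and it comes last; two active components cannot both
  -- end with it.
  have hp' : IsNil bar p' := by
    by_contra hp'
    obtain ⟨w, cw⟩ := exists_completed (bar := bar) p'
    obtain ⟨v, cv⟩ := exists_completed (bar := bar) (t.subst σ)
    have hw := cw.ne_nil hp'
    have hv := cv.ne_nil hn
    exact not_countP_append hw hv (cut (by simp [hw]) (hl w cw v cv))
      (cut (by simp [hw]) (hl' w cw v cv))
  have hform : ∀ w, w ≠ [] → Completed bar (t.subst σ) w →
      ∃ u, w = u ++ [some a] ∧ u.countP Option.isSome = 0 :=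
    fun w hw cw => cut hw (hl [] hp'.completed w cw)
  by_contra! hx
  -- Two lengths already suffice here: a completed trace of `σ x` extends to one of `t.subst σ`, so
  -- it has at most one visible action.
  have hx' : ∀ x, t.Exposed x → ¬ TwoLengths bar (σ x) := by
    intro x ex h2
    refine hx x ex ⟨h2, .inr ?_⟩
    obtain ⟨w, -, hw, -, cw, -⟩ := h2
    obtain ⟨v, hv⟩ := ex.exists_completed_append (bar := bar) (σ := σ)
    obtain ⟨u, e, hu⟩ := hform _ (by simp [hw]) (hv w hw cw)
    refine ⟨w, hw, cw, ?_⟩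
    have := congrArg (List.countP Option.isSome) e
    simp only [List.countP_append, List.countP_singleton, hu, Option.isSome_some, if_true] at this
    omega
  obtain ⟨S, hS, hS'⟩ := exists_lengths_card_le_width hx' hu hform
  -- The completed trace `τ^(j+1) a` has length `j + 2`.
  have : (Finset.range N).image (· + 2) ⊆ S := by
    intro l hl
    obtain ⟨j, hj, rfl⟩ := Finset.mem_image.1 hl
    simpa using hS' _ (by simp) ((hc j (Finset.mem_range.1 hj)).of_par_isNil_left hp')
  have := Finset.card_le_card this
  rw [Finset.card_image_of_injective _ (add_left_injective 2), Finset.card_range] at this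
  omega

theorem HasParSummand.exists_exposed (bar_ne : ∀ a, bar a ≠ a) (hN : 2 ≤ N) {t : Term A V}
    {σ : V → Proc A} (ht : t.width < N) (hp : FuturesIncl bar (t.subst σ) (witnessLeft a N))
    (h : HasParSummand bar a (t.subst σ)) : ∃ x, t.Exposed x ∧ Distinguishing bar a (σ x) := by
  induction t with
  | nil => exact h.elim
  | var x =>
    obtain ⟨r, hr⟩ := h.exists_step
    exact ⟨x, rfl, twoLengths_of_step_some bar_ne hN hp hr, .inl h⟩
  | pre α t => exact h.elim
  | add t u iht ihu =>
    rw [Term.width] at ht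
    rcases h with h | h
    · obtain ⟨x, ex, hx⟩ := iht (by omega) ((futuresIncl_add_left _ _).trans hp) h
      exact ⟨x, .inl ex, hx⟩
    · obtain ⟨x, ex, hx⟩ := ihu (by omega) ((futuresIncl_add_right _ _).trans hp) h
      exact ⟨x, .inr ex, hx⟩
  | par t u iht ihu =>
    rw [Term.width] at ht
    rcases h with ⟨hn, h⟩ | ⟨hn, h⟩ | ⟨hnt, hnu, r, hr⟩
    · obtain ⟨x, ex, hx⟩ := iht (by omega) ((futuresIncl_par_isNil_right _ hn).trans hp) h
      exact ⟨x, .inl ex, hx⟩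
    · obtain ⟨x, ex, hx⟩ := ihu (by omega) ((futuresIncl_par_isNil_left _ hn).trans hp) h
      exact ⟨x, .inr ex, hx⟩
    · have hN' : 1 ≤ N := by omega
      cases hr with
      | @parLeft _ _ p' _ hs =>
        have hs' := Step.parLeft (u.subst σ) hs
        obtain ⟨x, ex, hx⟩ := exists_exposed_of_step_some (a := a) (t := u) (by omega) hnu
          (fun w cw v cv => completed_of_futuresIncl bar_ne hN' hp (by simp)
            ((cw.par_left_first cv).cons hs'))
          (fun w cw v cv => completed_of_futuresIncl bar_ne hN' hp (by simp)
            ((cw.par_right_first cv).cons hs'))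
          (fun α q hq => by
            cases α with
            | some c => exact (not_step_some_of_step_some hp hs' (.parRight _ hq)).elim
            | none =>
              obtain ⟨l, hl⟩ := uniformLength_of_step_tau bar_ne hN' hp (.parRight _ hq)
              obtain ⟨v, cv⟩ := exists_completed (bar := bar) (t.subst σ)
              -- Completing the untouched partner along the fixed trace `v` shifts all lengths by
              -- the same amount.
              refine ⟨l - v.length, fun w cw => ?_⟩
              rw [← hl _ (cv.par_left_first cw), List.length_append, Nat.add_sub_cancel_left])
          (fun j hj => completed_of_step_some bar_ne hp hs' hj)
        exact ⟨x, .inr ex, hx⟩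
      | @parRight _ _ _ p' hs =>
        have hs' := Step.parRight (t.subst σ) hs
        obtain ⟨x, ex, hx⟩ := exists_exposed_of_step_some (a := a) (t := t) (by omega) hnt
          (fun w cw v cv => completed_of_futuresIncl bar_ne hN' hp (by simp)
            ((cv.par_right_first cw).cons hs'))
          (fun w cw v cv => completed_of_futuresIncl bar_ne hN' hp (by simp)
            ((cv.par_left_first cw).cons hs'))
          (fun α q hq => by
            cases α with
            | some c => exact (not_step_some_of_step_some hp hs' (.parLeft _ hq)).elim
            | none =>
              obtain ⟨l, hl⟩ := uniformLength_of_step_tau bar_ne hN' hp (.parLeft _ hq)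
              obtain ⟨v, cv⟩ := exists_completed (bar := bar) (u.subst σ)
              refine ⟨l - v.length, fun w cw => ?_⟩
              rw [← hl _ (cw.par_left_first cv), List.length_append, Nat.add_sub_cancel])
          (fun j hj => (completed_of_step_some bar_ne hp hs' hj).par_comm)
        exact ⟨x, .inl ex, hx⟩

/-- At a bare variable, a completed trace with at most one visible action would violate the count of
two. Beside an active component, that component cannot start with `τ`, since two lengths would
survive; hence it starts with `a`. -/
theorem Distinguishing.hasParSummand (bar_ne : ∀ a, bar a ≠ a) (hN : 1 ≤ N) {x : V} {t : Term A V}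
    {σ : V → Proc A} (hp : FuturesIncl bar (t.subst σ) (witnessLeft a N)) (ex : t.Exposed x)
    (hx : Distinguishing bar a (σ x)) : HasParSummand bar a (t.subst σ) := by
  induction t with
  | nil => exact ex.elim
  | var y =>
    cases ex
    rcases hx.2 with h | ⟨w, hw, cw, hle⟩
    · exact h
    · obtain ⟨u, rfl, hu⟩ := completed_of_futuresIncl bar_ne hN hp hw cw
      simp [hu] at hle
  | pre α t => exact ex.elim
  | add t u iht ihu =>
    rcases ex with ex | ex
    · exact .inl (iht ((futuresIncl_add_left _ _).trans hp) ex)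
    · exact .inr (ihu ((futuresIncl_add_right _ _).trans hp) ex)
  | par t u iht ihu =>
    rcases ex with ex | ex
    · have h2 := ex.twoLengths hx.1
      by_cases hn : IsNil bar (u.subst σ)
      · exact .inl ⟨hn, iht ((futuresIncl_par_isNil_right _ hn).trans hp) ex⟩
      · refine .inr (.inr ⟨h2.not_isNil, hn, ?_⟩)
        by_contra hno
        simp only [IsNil, not_forall, not_not] at hn
        obtain ⟨α, q, hq⟩ := hn
        cases α with
        | none =>
          exact (uniformLength_of_step_tau bar_ne hN hp (.parRight _ hq)).not_twoLengths
            (h2.par_left q)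
        | some b =>
          obtain ⟨rfl, -⟩ := traces_eq_of_step_some hp (.parRight _ hq)
          exact hno ⟨_, .parRight _ hq⟩
    · have h2 := ex.twoLengths hx.1
      by_cases hn : IsNil bar (t.subst σ)
      · exact .inr (.inl ⟨hn, ihu ((futuresIncl_par_isNil_left _ hn).trans hp) ex⟩)
      · refine .inr (.inr ⟨hn, h2.not_isNil, ?_⟩)
        by_contra hno
        simp only [IsNil, not_forall, not_not] at hn
        obtain ⟨α, q, hq⟩ := hn
        cases α with
        | none =>
          exact (uniformLength_of_step_tau bar_ne hN hp (.parLeft _ hq)).not_twoLengths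
            (h2.par_right q)
        | some b =>
          obtain ⟨rfl, -⟩ := traces_eq_of_step_some hp (.parLeft _ hq)
          exact hno ⟨_, .parLeft _ hq⟩

/-! ### Transfer across a sound equation -/

theorem HasParSummand.of_sound (bar_ne : ∀ a, bar a ≠ a) (hN : 2 ≤ N) {t u : Term A V}
    (htu : ∀ σ : V → Proc A, PFEquiv bar (t.subst σ) (u.subst σ)) (ht : t.width < N)
    {σ : V → Proc A} (hp : FuturesIncl bar (t.subst σ) (witnessLeft a N))
    (h : HasParSummand bar a (t.subst σ)) : HasParSummand bar a (u.subst σ) := by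
  classical
  have hN' : 1 ≤ N := by omega
  obtain ⟨x, ex, hx⟩ := h.exists_exposed bar_ne hN ht hp
  have hq := (pfEquiv_iff.1 (htu σ)).2.2.trans hp
  -- The value `τ^(N+1)` is a probe: its trace is impossible under `σ`, so its appearance on the
  -- other side reveals an occurrence of `x`.
  let σ' := Function.update σ x ((Term.pre none)^[N + 1] .nil)
  have hmem : List.replicate (N + 1) none ∈ traces bar (u.subst σ') := by
    rw [← (htu σ').traces_eq]
    apply ex.traces_subset
    simp only [σ', Function.update_self]
    generalize N + 1 = n
    refine ⟨.nil, ?_⟩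
    induction n with
    | zero => rfl
    | succ n ih => rw [Function.iterate_succ_apply']; exact ⟨_, .pre _ _, ih⟩
  rcases exists_exposed_of_mem_traces (σ := σ) (fun y hy => Function.update_of_ne hy _ _) hmem with
    h | ⟨v, u', hv, hs, ex'⟩
  · exact (replicate_none_notMem_traces bar_ne hq h).elim
  -- With an empty prefix, `x` is exposed in a term with the same instance as `u`. Otherwise the
  -- prefix starts with `τ`, after which two lengths are impossible.
  · cases v with
    | nil =>
      change u.subst σ = u'.subst σ at hs
      rw [hs] at hq ⊢
      exact hx.hasParSummand bar_ne hN' hq ex'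
    | cons α v =>
      obtain rfl : α = none := List.eq_of_mem_replicate (hv.subset (by simp))
      obtain ⟨q, hs, hs'⟩ := hs
      exact ((uniformLength_of_step_tau bar_ne hN' hq hs).not_twoLengths
        ((ex'.twoLengths hx.1).steps hs')).elim

end

/-! ### The invariant of derivations -/

theorem Term.subst_subst {W X : Type*} (σ : V → Term A W) (ρ : W → Term A X) (t : Term A V) :
    (t.subst σ).subst ρ = t.subst fun x => (σ x).subst ρ := by
  induction t with
  | nil => rfl
  | var x => rfl
  | pre α p ih => exact congrArg _ ih
  | add p q ihp ihq => exact congrArg₂ _ ihp ihq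
  | par p q ihp ihq => exact congrArg₂ _ ihp ihq

/-- Being below `a ∥ q_N` passes to summands and to partners of inert components, so the induction
hypotheses apply there. For two active components the property depends only on the possible futures
class. -/
theorem Derivable.invariant (bar_ne : ∀ a, bar a ≠ a) {a : A} {N : ℕ} (hN : 2 ≤ N)
    {E : AxiomSystem A} (hE : Sound (PFEquiv bar) E)
    (hw : ∀ t u, (t, u) ∈ E → t.width < N ∧ u.width < N) {t u : OpenTerm A}
    (h : Derivable E t u) (σ : ℕ → Proc A) :
    PFEquiv bar (t.subst σ) (u.subst σ) ∧ (FuturesIncl bar (t.subst σ) (witnessLeft a N) →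
      (HasParSummand bar a (t.subst σ) ↔ HasParSummand bar a (u.subst σ))) := by
  induction h generalizing σ with
  | @ax t u h =>
    refine ⟨hE t u h σ, fun hp => ⟨fun hs => ?_, fun hs => ?_⟩⟩
    · exact hs.of_sound bar_ne hN (hE t u h) (hw t u h).1 hp
    · exact hs.of_sound bar_ne hN (fun ρ => (hE t u h ρ).symm) (hw t u h).2
        ((pfEquiv_iff.1 (hE t u h σ)).2.2.trans hp)
  | refl t => exact ⟨rfl, fun _ => Iff.rfl⟩
  | symm _ ih =>
    exact ⟨(ih σ).1.symm, fun hp => ((ih σ).2 ((pfEquiv_iff.1 (ih σ).1).2.1.trans hp)).symm⟩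
  | trans _ _ ih ih' =>
    exact ⟨(ih σ).1.trans (ih' σ).1, fun hp =>
      ((ih σ).2 hp).trans ((ih' σ).2 ((pfEquiv_iff.1 (ih σ).1).2.2.trans hp))⟩
  | subst ρ _ ih => simp only [Term.subst_subst]; exact ih _
  | pre α _ ih => exact ⟨(ih σ).1.pre α, fun _ => Iff.rfl⟩
  | add _ _ ih ih' =>
    exact ⟨(ih σ).1.add (ih' σ).1, fun hp =>
      or_congr ((ih σ).2 ((futuresIncl_add_left _ _).trans hp))
        ((ih' σ).2 ((futuresIncl_add_right _ _).trans hp))⟩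
  | @par t u t' u' _ _ ih ih' =>
    have hpar := (ih σ).1.par (ih' σ).1
    have hnil : ∀ {p q : Proc A}, PFEquiv bar p q → (IsNil bar p ↔ IsNil bar q) := fun h =>
      ⟨fun hp => hp.congr h.traces_eq, fun hq => hq.congr h.traces_eq.symm⟩
    have hstep : ∀ {p q : Proc A}, PFEquiv bar p q →
        (∃ r, Step bar p (some a) r) → ∃ r, Step bar q (some a) r := by
      rintro p q h ⟨r, hr⟩
      obtain ⟨_, s, hs, -⟩ : [some a] ∈ traces bar q := h.traces_eq ▸ ⟨r, r, hr, rfl⟩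
      exact ⟨s, hs⟩
    refine ⟨hpar, fun hp => or_congr ?_ (or_congr ?_ ?_)⟩
    · rw [← hnil (ih' σ).1]
      exact and_congr_right fun hn => (ih σ).2 ((futuresIncl_par_isNil_right _ hn).trans hp)
    · rw [← hnil (ih σ).1]
      exact and_congr_right fun hn => (ih' σ).2 ((futuresIncl_par_isNil_left _ hn).trans hp)
    · rw [← hnil (ih σ).1, ← hnil (ih' σ).1]
      exact and_congr_right fun _ => and_congr_right fun _ => ⟨hstep hpar, hstep hpar.symm⟩

/-! ### The witness equations and non-derivability -/

theorem hasParSummand_witnessLeft (a : A) {N : ℕ} (hN : 1 ≤ N) :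
    HasParSummand bar a (witnessLeft a N) :=
  .inr (.inr ⟨fun h => h _ _ (.pre _ _), fun h => h _ _ (step_qProc.2 ⟨rfl, 0, hN, rfl⟩), _,
    step_witnessLeft.2 (.inl ⟨rfl, rfl⟩)⟩)

theorem not_hasParSummand_sum {a : A} {l : List (Proc A)}
    (h : ∀ p ∈ l, ¬ HasParSummand bar a p) : ¬ HasParSummand bar a (sum l) := by
  induction l using sum.induct with
  | case1 => exact id
  | case2 t => exact h t (by simp)
  | case3 t u ts ih =>
    rw [List.forall_mem_cons] at h
    exact not_or.2 ⟨h.1, ih h.2⟩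

theorem not_hasParSummand_witnessRight (a : A) (N : ℕ) :
    ¬ HasParSummand bar a (witnessRight a N) := by
  refine not_or.2 ⟨id, not_hasParSummand_sum fun p hp => ?_⟩
  obtain ⟨j, -, rfl⟩ := List.mem_map.1 hp
  exact id

theorem exists_not_derivable (bar_ne : ∀ a, bar a ≠ a) (a : A) {E : AxiomSystem A}
    (hfin : E.Finite) (hE : Sound (PFEquiv bar) E) :
    ∃ N₀ : ℕ, ∀ N, N₀ ≤ N →
      ¬ Derivable E (witnessLeft a N).toOpen (witnessRight a N).toOpen := by
  obtain ⟨B, hB⟩ := (hfin.image fun e => e.1.width + e.2.width).bddAbove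
  -- This makes `N` exceed the width of every axiom side, and gives the `2 ≤ N` needed for two
  -- different lengths after `a`.
  refine ⟨B + 2, fun N hN hd => ?_⟩
  have hw : ∀ t u, (t, u) ∈ E → t.width < N ∧ u.width < N := by
    intro t u h
    have : t.width + u.width ≤ B := hB ⟨(t, u), h, rfl⟩
    omega
  have hinv := hd.invariant bar_ne (a := a) (N := N) (by omega) hE hw fun _ => .nil
  have htoOpen : ∀ p : Proc A, p.toOpen.subst (fun _ => .nil) = p := Proc.subst_lift _
  rw [htoOpen, htoOpen] at hinv
  exact not_hasParSummand_witnessRight a N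
    ((hinv.2 fun w p _ hp => ⟨p, hp, rfl⟩).1 (hasParSummand_witnessLeft a (by omega)))

theorem not_hasFiniteGroundCompleteAxiomatisation (bar_ne : ∀ a, bar a ≠ a) (a : A)
    {R : Proc A → Proc A → Prop} (hB : ∀ p q, Bisimilar bar p q → R p q)
    (hPF : ∀ p q, R p q → PFEquiv bar p q) : ¬ HasFiniteGroundCompleteAxiomatisation R := by
  rintro ⟨E, hfin, hsound, hcomplete⟩
  obtain ⟨N, hN⟩ := exists_not_derivable bar_ne a hfin
    fun t u h σ => hPF _ _ (hsound t u h σ)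
  exact hN N le_rfl (hcomplete _ _ (hB _ _ (bisimilar_witness a N)))

end BCCSPpar


theorem mainTheorem4 {A : Type*} [Finite A] (bar : A → A)
    (bar_bar : ∀ a, bar (bar a) = a) (bar_ne : ∀ a, bar a ≠ a)
    (hcard : 2 ≤ Nat.card (BCCSPpar.ActTau A)) :
    -- possible futures equivalence has no finite, ground-complete axiomatisation
    ¬ BCCSPpar.HasFiniteGroundCompleteAxiomatisation (BCCSPpar.PFEquiv bar) ∧
    -- nor has any congruence between bisimilarity and possible futures equivalence
    (∀ R : BCCSPpar.Proc A → BCCSPpar.Proc A → Prop, BCCSPpar.IsCongruence R →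
      (∀ p q, BCCSPpar.Bisimilar bar p q → R p q) →
      (∀ p q, R p q → BCCSPpar.PFEquiv bar p q) →
      ¬ BCCSPpar.HasFiniteGroundCompleteAxiomatisation R) ∧
    -- for each action `a`, the witness family is sound, and no finite axiom system that is sound
    -- modulo possible futures equivalence derives more than finitely many of its equations
    (∀ a : A,
      (∀ N, 1 ≤ N →
        BCCSPpar.Bisimilar bar (BCCSPpar.witnessLeft a N) (BCCSPpar.witnessRight a N) ∧
        BCCSPpar.PFEquiv bar (BCCSPpar.witnessLeft a N) (BCCSPpar.witnessRight a N)) ∧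
      (∀ E : BCCSPpar.AxiomSystem A, E.Finite → BCCSPpar.Sound (BCCSPpar.PFEquiv bar) E →
        ∃ N₀ : ℕ, ∀ N, N₀ ≤ N →
          ¬ BCCSPpar.Derivable E (BCCSPpar.witnessLeft a N).toOpen
            (BCCSPpar.witnessRight a N).toOpen)) := by
  have : Nonempty A := by
    by_contra h
    rw [not_nonempty_iff] at h
    simp at hcard
  obtain ⟨a₀⟩ := this
  exact ⟨BCCSPpar.not_hasFiniteGroundCompleteAxiomatisation bar_ne a₀
      (fun _ _ h => h.pfEquiv) (fun _ _ h => h),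
    fun R _ hB hPF => BCCSPpar.not_hasFiniteGroundCompleteAxiomatisation bar_ne a₀ hB hPF,
    fun a => ⟨fun N _ => ⟨BCCSPpar.bisimilar_witness a N, (BCCSPpar.bisimilar_witness a N).pfEquiv⟩,
      fun _ hfin hE => BCCSPpar.exists_not_derivable bar_ne a hfin hE⟩⟩
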